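/- Let $q\ge 1$ and let $\phi=(\phi_1,\dots,\phi_q):[0,1]\to\mathbb{R}^q$ be such that: the support $\mathcal{T}_k$ of each $\phi_k$ is a compact subset of $(0,1)$; each $\phi_k$ is Lipschitz continuous; $\int_0^1\phi_k(u)\,du=0$ and $\int_0^1\phi_k(u)^2\,du=1$ for every $k$; and $\phi_1,\dots,\phi_q$ are linearly independent. Put $\tau_{\min}=\inf(\mathcal{T}_1\cup\dots\cup\mathcal{T}_q)$, $\tau_{\max}=\sup(\mathcal{T}_1\cup\dots\cup\mathcal{T}_q)$ and $\Sigma_{k,s}=\int_0^1\phi_k(u)\phi_s(u)\,du$ for $k,s=1,\dots,q$. Let $\mathcal{P}_0$ be a set of distributions $P$ of $(X,Y,Z)$ on $[0,1]\times[0,1]\times[0,1]^d$ that are absolutely continuous with respect to Lebesgue measure, and let $\mathcal{H}_0\subseteq\mathcal{P}_0$ be the subset of those under which $X$ and $Y$ are conditionally independent given $Z$. For $P\in\mathcal{P}_0$ let $F_{X\mid Z}(t\mid z)$ be the conditional distribution function of $X$ given $Z=z$ (computed from any fixed regular conditional distribution), let $Q_{X\mid Z}(\tau\mid z)=\inf\{t\in[0,1]: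 F_{X\mid Z}(t\mid z)\ge\tau\}$, and for $f:[0,1]\times[0,1]^d\to\mathbb{R}$ put $$\|f\|_{\mathcal{T},\infty}=\sup_{z\in[0,1]^d}\ \sup_{t\in[Q_{X\mid Z}(\tau_{\min}\mid z),\,Q_{X\mid Z}(\tau_{\max}\mid z)]}|f(t,z)|,\qquad \|f\|_{\mathcal{T}^c,\infty}=\sup_{z\in[0,1]^d}\ \sup_{t\in[0,1]\setminus[Q_{X\mid Z}(\tau_{\min}\mid z),\,Q_{X\mid Z}(\tau_{\max}\mid z)]}|f(t,z)|.$$ Define $F_{Y\mid Z}$, $Q_{Y\mid Z}$, $\|\cdot\|'_{\mathcal{T},\infty}$ and $\|\cdot\|'_{\mathcal{T}^c,\infty}$ in the same way with $Y$ in place of $X$. For each $n$ let $(X_i,Y_i,Z_i)_{i=1}^n$ be an i.i.d. sample from $P$. Let $\hat F^{(n)}_{X\mid Z}$ be an estimator that depends measurably on $(X_i,Z_i)_{i=1}^n$ only, and $\hat F^{(n)}_{Y\mid Z}$ one that depends measurably on $(Y_i,Z_i)_{i=1}^n$ only, both the same for all $P$, such that for every $z\in[0,1]^d$ the functions $\hat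 F^{(n)}_{X\mid Z}(\cdot\mid z)$ and $\hat F^{(n)}_{Y\mid Z}(\cdot\mid z)$ from $[0,1]$ to $[0,1]$ are continuous and increasing (not necessarily strictly), with value $0$ at $0$ and $1$ at $1$. For statistics $D_n$ and deterministic $a_n$, write $D_n\in\mathcal{O}_P(a_n)$ if for every $\epsilon>0$ there is $M>0$ with $P(|D_n|>M|a_n|)<\epsilon$ for all $n\ge1$. Suppose that for each $P\in\mathcal{P}_0$ there are deterministic sequences $g_P(n)\to0$ and $h_P(n)\to0$ with $\sqrt n\,g_P(n)h_P(n)\to0$, and functions $\xi,\xi':[0,1]\times[0,1]^d\to\mathbb{R}$, such that $$\|F_{X\mid Z}-\hat F^{(n)}_{X\mid Z}\|_{\mathcal{T},\infty}\in\mathcal{O}_P(g_P(n)),\qquad \|F_{Y\mid Z}-\hat F^{(n)}_{Y\mid Z}\|'_{\mathcal{T},\infty}\in\mathcal{O}_P(h_P(n)),$$ $$\|\xi-\hat F^{(n)}_{X\mid Z}\|_{\mathcal{T}^c,\infty}\in\mathcal{O}_P(g_P(n)),\qquad \|\xi'-\hat F^{(n)}_{Y\mid Z}\|'_{\mathcal{T}^c,\infty}\in\mathcal{O}_P(h_P(n)).$$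 Let $\hat U_{1,i}=\hat F^{(n)}_{X\mid Z}(X_i\mid Z_i)$, $\hat U_{2,i}=\hat F^{(n)}_{Y\mid Z}(Y_i\mid Z_i)$, $$\hat\rho_n=\frac1n\sum_{i=1}^n\phi(\hat U_{1,i})\phi(\hat U_{2,i})^T,\qquad T_n=\|\Sigma^{-1/2}\hat\rho_n\Sigma^{-1/2}\|_F^2,$$ where $\|\cdot\|_F$ is the Frobenius norm. Then for each fixed $P\in\mathcal{H}_0$ the statistic $nT_n$ converges in distribution under $P$, as $n\to\infty$, to the $\chi^2$-distribution with $q^2$ degrees of freedom. -/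

import Mathlib

open MeasureTheory ProbabilityTheory Filter Topology
open scoped ENNReal unitInterval

namespace PartialCopula

/-- The covariate space `[0,1]^d`. -/
abbrev Cube (d : ℕ) : Type := Fin d → I

/-- The observation space `[0,1]^(2+d)`; an observation is `w = (x, y, z)`. Its `volume` is Lebesgue
measure on the hypercube. -/
abbrev Obs (d : ℕ) : Type := I × I × Cube d

/-- The joint law of `(Z, X)` under `P`. -/
noncomputable def lawZX {d : ℕ} (P : Measure (Obs d)) : Measure (Cube d × I) :=
  P.map fun w => (w.2.2, w.1)

/-- The joint law of `(Z, Y)` under `P`. -/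
noncomputable def lawZY {d : ℕ} (P : Measure (Obs d)) : Measure (Cube d × I) :=
  P.map fun w => (w.2.2, w.2.1)

/-- `F z t` is (a version of) the conditional distribution function `F(t | z)` of the second
coordinate given the first one under `μ`: it comes from a regular conditional distribution. -/
def IsCondCDF {d : ℕ} (μ : Measure (Cube d × I)) (F : Cube d → I → ℝ) : Prop :=
  ∃ κ : Kernel (Cube d) I, IsMarkovKernel κ ∧ μ.IsCondKernel κ ∧
    ∀ z t, F z t = (κ z).real (Set.Iic t)

/-- `X` and `Y` are conditionally independent given `Z` when `(X, Y, Z)` has law `P`. -/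
def CondIndepXY {d : ℕ} (P : ProbabilityMeasure (Obs d)) : Prop :=
  CondIndepFun (MeasurableSpace.comap (fun w : Obs d => w.2.2) inferInstance)
    (measurable_snd.snd.comap_le) (fun w : Obs d => w.1) (fun w : Obs d => w.2.1)
    (P : Measure (Obs d))

/-- The conditional quantile function `Q(τ | z) = inf {t ∈ [0,1] | F(t | z) ≥ τ}`. -/
noncomputable def condQuantile {d : ℕ} (F : Cube d → I → ℝ) (τ : ℝ) (z : Cube d) : ℝ :=
  sInf {t : ℝ | ∃ ht : t ∈ I, τ ≤ F z ⟨t, ht⟩}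

/-- The conditions on the function `φ = (φ_1, …, φ_q) : [0,1] → ℝ^q` that defines the generalized
correlation. The support `tsupport (φ k)` is closed in `[0,1]`, hence compact. -/
structure IsCorrelationMap {q : ℕ} (φ : Fin q → I → ℝ) : Prop where
  support_subset : ∀ k, tsupport (φ k) ⊆ Set.Ioo 0 1
  lipschitz : ∀ k, ∃ L, LipschitzWith L (φ k)
  integral_eq_zero : ∀ k, ∫ u, φ k u = 0
  integral_sq_eq_one : ∀ k, ∫ u, φ k u ^ 2 = 1
  linearIndependent : LinearIndependent ℝ φ

/-- The union of the supports of the coordinates of `φ`, as a subset of the real line. -/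
def supportUnion {q : ℕ} (φ : Fin q → I → ℝ) : Set ℝ :=
  ⋃ k, (fun u : I => (u : ℝ)) '' tsupport (φ k)

noncomputable def tauMin {q : ℕ} (φ : Fin q → I → ℝ) : ℝ := sInf (supportUnion φ)

noncomputable def tauMax {q : ℕ} (φ : Fin q → I → ℝ) : ℝ := sSup (supportUnion φ)

/-- `Q(𝒯 | z) = [Q(τ_min | z), Q(τ_max | z)]`, as a subset of `[0,1]`. -/
def quantileRange {q d : ℕ} (φ : Fin q → I → ℝ) (F : Cube d → I → ℝ) (z : Cube d) : Set I :=
  {t | (t : ℝ) ∈ Set.Icc (condQuantile F (tauMin φ) z) (condQuantile F (tauMax φ) z)}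

/-- The supremum of `|f z t|` over `z ∈ [0,1]^d` and `t ∈ S z`, with values in `[0,∞]`. -/
noncomputable def supOver {d : ℕ} (S : Cube d → Set I) (f : Cube d → I → ℝ) : ℝ≥0∞ :=
  ⨆ z, ⨆ t ∈ S z, ENNReal.ofReal |f z t|

/-- An estimator of a conditional distribution function: for each sample size `n` a measurable map
from a sample `(X_i, Z_i)_{i ≤ n}` to a function `(z, t) ↦ F̂(t | z)` that is continuous and
increasing in `t`, from `0` at `t = 0` to `1` at `t = 1`. -/
structure CondCDFEstimator (d : ℕ) where
  est : (n : ℕ) → (Fin n → I × Cube d) → Cube d → I → I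
  measurable_est : ∀ n,
    Measurable fun p : (Fin n → I × Cube d) × Cube d × I => est n p.1 p.2.1 p.2.2
  continuous_est : ∀ n s z, Continuous (est n s z)
  monotone_est : ∀ n s z, Monotone (est n s z)
  est_zero : ∀ n s z, est n s z 0 = 0
  est_one : ∀ n s z, est n s z 1 = 1

/-- The sample `(X_i, Z_i)_{i ≤ n}`. -/
def sampleXZ {d n : ℕ} (w : Fin n → Obs d) : Fin n → I × Cube d := fun i => ((w i).1, (w i).2.2)

/-- The sample `(Y_i, Z_i)_{i ≤ n}`. -/
def sampleYZ {d n : ℕ} (w : Fin n → Obs d) : Fin n → I × Cube d := fun i => ((w i).2.1, (w i).2.2)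

/-- The law of an i.i.d. sample of size `n` from `P`. -/
noncomputable def sampleLaw {d : ℕ} (P : ProbabilityMeasure (Obs d)) (n : ℕ) :
    Measure (Fin n → Obs d) :=
  Measure.pi fun _ => (P : Measure (Obs d))

instance {d : ℕ} (P : ProbabilityMeasure (Obs d)) (n : ℕ) :
    IsProbabilityMeasure (sampleLaw P n) := by
  unfold sampleLaw; infer_instance

/-- `D n ∈ O_P(a n)`: stochastic boundedness of a nonnegative statistic of the `n`-sample by the
deterministic sequence `a`. -/
def IsBigOInProb {d : ℕ} (P : ProbabilityMeasure (Obs d)) (D : (n : ℕ) → (Fin n → Obs d) → ℝ≥0∞)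
    (a : ℕ → ℝ) : Prop :=
  ∀ ε : ℝ, 0 < ε → ∃ M : ℝ, 0 < M ∧ ∀ n : ℕ, 1 ≤ n →
    sampleLaw P n {w | ENNReal.ofReal (M * |a n|) < D n w} < ENNReal.ofReal ε

/-- The estimators `Fhat` (of `X` given `Z`) and `Ghat` (of `Y` given `Z`) are consistent at `P`
for the conditional distribution functions `F` and `G`, with rates `g` and `h`, over the conditional
`𝒯`-quantiles, and converge at these rates to some limits `ξ` and `ξ'` over the conditional
`𝒯ᶜ`-quantiles. -/
def ConsistentAt {q d : ℕ} (φ : Fin q → I → ℝ) (Fhat Ghat : CondCDFEstimator d)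
    (P : ProbabilityMeasure (Obs d)) (F G : Cube d → I → ℝ) (g h : ℕ → ℝ) : Prop :=
  Tendsto g atTop (𝓝 0) ∧ Tendsto h atTop (𝓝 0) ∧
  IsBigOInProb P (fun n w => supOver (quantileRange φ F)
    fun z t => F z t - Fhat.est n (sampleXZ w) z t) g ∧
  IsBigOInProb P (fun n w => supOver (quantileRange φ G)
    fun z t => G z t - Ghat.est n (sampleYZ w) z t) h ∧
  ∃ ξ ξ' : Cube d → I → ℝ,
    IsBigOInProb P (fun n w => supOver (fun z => (quantileRange φ F z)ᶜ)
      fun z t => ξ z t - Fhat.est n (sampleXZ w) z t) g ∧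
    IsBigOInProb P (fun n w => supOver (fun z => (quantileRange φ G z)ᶜ)
      fun z t => ξ' z t - Ghat.est n (sampleYZ w) z t) h

/-- The empirical generalized correlation
`n⁻¹ ∑ i, φ(F̂(X_i | Z_i)) φ(Ĝ(Y_i | Z_i))ᵀ` of the estimated nonparametric residuals. -/
noncomputable def rhoHat {q d : ℕ} (φ : Fin q → I → ℝ) (Fhat Ghat : CondCDFEstimator d) (n : ℕ)
    (w : Fin n → Obs d) : Matrix (Fin q) (Fin q) ℝ :=
  Matrix.of fun k l => (n : ℝ)⁻¹ * ∑ i : Fin n,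
    φ k (Fhat.est n (sampleXZ w) (w i).2.2 (w i).1) *
      φ l (Ghat.est n (sampleYZ w) (w i).2.2 (w i).2.1)

/-- The matrix `Σ` with entries `∫₀¹ φ_k(u) φ_s(u) du`. -/
noncomputable def sigmaMatrix {q : ℕ} (φ : Fin q → I → ℝ) : Matrix (Fin q) (Fin q) ℝ :=
  Matrix.of fun k s => ∫ u, φ k u * φ s u

/-- The inverse square root `A^(-1/2)` of a positive definite matrix, by functional calculus. -/
noncomputable def invSqrt {q : ℕ} (A : Matrix (Fin q) (Fin q) ℝ) : Matrix (Fin q) (Fin q) ℝ :=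
  cfc (fun x : ℝ => (Real.sqrt x)⁻¹) A

noncomputable def frobeniusNorm {q : ℕ} (A : Matrix (Fin q) (Fin q) ℝ) : ℝ :=
  Real.sqrt (∑ k, ∑ l, A k l ^ 2)

/-- The statistic `T_n = ‖Σ^(-1/2) ρ̂_n Σ^(-1/2)‖_F²`. -/
noncomputable def testStat {q d : ℕ} (φ : Fin q → I → ℝ) (Fhat Ghat : CondCDFEstimator d) (n : ℕ)
    (w : Fin n → Obs d) : ℝ :=
  frobeniusNorm (invSqrt (sigmaMatrix φ) * rhoHat φ Fhat Ghat n w * invSqrt (sigmaMatrix φ)) ^ 2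

/-- The chi-squared distribution with `k` degrees of freedom: the law of the sum of the squares of
`k` independent standard normal variables. -/
noncomputable def chiSquared (k : ℕ) : Measure ℝ :=
  (Measure.pi fun _ : Fin k => gaussianReal 0 1).map fun x => ∑ i, x i ^ 2

instance (k : ℕ) : IsProbabilityMeasure (chiSquared k) :=
  Measure.isProbabilityMeasure_map
    (Measurable.aemeasurable (by fun_prop : Measurable fun x : Fin k → ℝ => ∑ i, x i ^ 2))

end PartialCopula

open PartialCopula

/-! Write `U = F(X | Z)` and `V = G(Y | Z)` for the true residuals, and `ψ = Σ^(-1/2) φ` for the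
whitened map (`whitened`), whose coordinates are centred and orthonormal in `L²[0,1]`. Then `n T_n`
is the sum over pairs `(k, l)` of the squares of `n^(-1/2) ∑ i, ψ_k(Û_i) ψ_l(V̂_i)`
(`natCast_mul_testStat`).

With the true residuals the limit is classical. Under conditional independence `V` is uniform and
independent of `(X, Z)` (`map_residual_eq_prod`), hence of `U`. The `q²` products `ψ_k(U) ψ_l(V)`
are therefore centred and orthonormal, and the multivariate central limit theorem with continuous
mapping gives the chi-squared law. This survives perturbations that vanish in probability
(`tendstoInDistribution_sum_sq`).

To pass to the estimated residuals, put `A = ψ_k(Û) - ψ_k(U)` and `B = ψ_l(V̂) - ψ_l(V)`. The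
summand changes by `A ψ_l(V) + ψ_k(U) B + A B`. The last term contributes at most the order of `√n g
h` (`vanishesInProb_mul`). For the first two the rates alone do not suffice, since `√n g` need not
vanish. But `A` depends only on the sample of `(X, Z)`, which is independent of the sample of `V`:
given the former, the normalized sum is centred and its variance is the mean of the `A²`, which
tends to zero (`vanishesInProb_sum_mul_residual`). The second term is symmetric.

The errors are controlled everywhere, although consistency is used only on the quantile range: `ψ`
vanishes outside `[τ_min, τ_max]`, and monotone estimators keep any overshoot outside the range
below the error at its endpoints (`abs_comp_sub_comp_le`). -/

namespace PartialCopula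

/-! ### Distribution functions on the unit interval and the probability integral transform -/

/-- Dominated convergence: as a function of `t`, the indicator of `s ≤ t` jumps only at `t = s`, so
at a given `t₀` it is continuous for almost every `s`. -/
lemma continuous_real_Iic (ν : Measure I) [IsProbabilityMeasure ν] (hν : ∀ t, ν {t} = 0) :
    Continuous fun t : I => ν.real (Set.Iic t) := by
  have heq : (fun t : I => ν.real (Set.Iic t)) =
      fun t => ∫ s, (Set.Iic t).indicator (fun _ => (1 : ℝ)) s ∂ν := by
    funext t
    rw [integral_indicator measurableSet_Iic]
    simp
  rw [heq, continuous_iff_continuousAt]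
  intro t₀
  refine continuousAt_of_dominated (bound := fun _ => 1) ?_ ?_ (integrable_const _) ?_
  · exact Eventually.of_forall fun t =>
      (measurable_const.indicator measurableSet_Iic).aestronglyMeasurable
  · refine Eventually.of_forall fun t => Eventually.of_forall fun s => ?_
    by_cases h : s ∈ Set.Iic t <;> simp [h]
  · have : ∀ᵐ s ∂ν, s ≠ t₀ := by
      rw [ae_iff]; simpa using hν t₀
    filter_upwards [this] with s hs
    rcases lt_or_gt_of_ne hs with h | h
    · refine (continuousAt_const (y := (1 : ℝ))).congr ?_
      filter_upwards [lt_mem_nhds h] with t ht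
      simp [ht.le]
    · refine (continuousAt_const (y := (0 : ℝ))).congr ?_
      filter_upwards [gt_mem_nhds h] with t ht
      simp [not_le.mpr ht]

/-- The distribution function of a probability measure on `[0,1]`, with values in `[0,1]`. -/
noncomputable def distFun (ν : Measure I) [IsProbabilityMeasure ν] (t : I) : I :=
  ⟨ν.real (Set.Iic t), measureReal_nonneg, measureReal_le_one⟩

lemma monotone_distFun (ν : Measure I) [IsProbabilityMeasure ν] : Monotone (distFun ν) :=
  fun _ _ h => Subtype.mk_le_mk.2 (measureReal_mono (Set.Iic_subset_Iic.2 h))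

lemma distFun_one (ν : Measure I) [IsProbabilityMeasure ν] : distFun ν 1 = 1 := by
  have : (Set.Iic (1 : I)) = Set.univ := Set.eq_univ_of_forall fun t => unitInterval.le_one'
  ext
  simp [distFun, this]

lemma distFun_zero (ν : Measure I) [IsProbabilityMeasure ν] (hν : ν {0} = 0) :
    distFun ν 0 = 0 := by
  have : (Set.Iic (0 : I)) = {0} := by
    exact Set.Subset.antisymm (fun t ht => le_antisymm ht unitInterval.nonneg') (by simp)
  ext
  simp [distFun, this, Measure.real, hν]

lemma continuous_distFun (ν : Measure I) [IsProbabilityMeasure ν] (hν : ∀ t, ν {t} = 0) :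
    Continuous (distFun ν) :=
  (continuous_real_Iic ν hν).subtype_mk _

/-- The probability integral transform. -/
lemma map_distFun (ν : Measure I) [IsProbabilityMeasure ν] (hν : ∀ t, ν {t} = 0) :
    ν.map (distFun ν) = volume := by
  have hc := continuous_distFun ν hν
  have : IsProbabilityMeasure (ν.map (distFun ν)) :=
    Measure.isProbabilityMeasure_map hc.measurable.aemeasurable
  refine Measure.ext_of_Iic _ _ fun u => ?_
  rw [Measure.map_apply hc.measurable measurableSet_Iic, unitInterval.volume_Iic]
  have hcomp : IsCompact (distFun ν ⁻¹' Set.Iic u) := (isClosed_Iic.preimage hc).isCompact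
  have hne : (distFun ν ⁻¹' Set.Iic u).Nonempty :=
    ⟨0, by simp [distFun_zero ν (hν 0)]⟩
  -- The distribution function may have flat pieces. The greatest point of the sublevel set absorbs
  -- them and makes that set exactly `Set.Iic t₀`.
  obtain ⟨t₀, ht₀, hmax⟩ := hcomp.exists_isGreatest hne
  obtain ⟨t₁, ht₁⟩ := intermediate_value_univ 0 1 hc
    (show u ∈ Set.Icc (distFun ν 0) (distFun ν 1) by
      rw [distFun_zero ν (hν 0), distFun_one]
      exact ⟨unitInterval.nonneg', unitInterval.le_one'⟩)
  have hu : distFun ν t₀ = u :=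
    le_antisymm ht₀ (ht₁ ▸ monotone_distFun ν (hmax (show distFun ν t₁ ≤ u from ht₁.le)))
  have hset : distFun ν ⁻¹' Set.Iic u = Set.Iic t₀ :=
    Set.Subset.antisymm (fun t ht => hmax ht) fun t ht => (monotone_distFun ν ht).trans hu.le
  rw [hset, ← ofReal_measureReal]
  congr 1
  exact congrArg Subtype.val hu

/-! ### Regular conditional distributions -/

variable {d : ℕ}

/-- Joint measurability comes from viewing the set as a section of a measurable subset of `(A × I) ×
I`, with `κ` extended to ignore the second argument. -/
lemma measurable_kernel_Iic {A : Type*} [MeasurableSpace A] (κ : Kernel A I) [IsMarkovKernel κ] :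
    Measurable fun p : A × I => κ p.1 (Set.Iic p.2) := by
  have h : MeasurableSet {x : (A × I) × I | x.2 ≤ x.1.2} :=
    measurableSet_le measurable_snd measurable_fst.snd
  exact Kernel.measurable_kernel_prodMk_left (κ := Kernel.prodMkRight I κ) h

lemma measurable_kernel_singleton {A : Type*} [MeasurableSpace A] (κ : Kernel A I)
    [IsMarkovKernel κ] : Measurable fun p : A × I => κ p.1 {p.2} := by
  have h : MeasurableSet {x : (A × I) × I | x.2 = x.1.2} :=
    measurableSet_eq_fun measurable_snd measurable_fst.snd
  exact Kernel.measurable_kernel_prodMk_left (κ := Kernel.prodMkRight I κ) h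

lemma measurable_distFun_kernel {A : Type*} [MeasurableSpace A] (κ : Kernel A I)
    [IsMarkovKernel κ] : Measurable fun p : A × I => distFun (κ p.1) p.2 :=
  ((measurable_kernel_Iic κ).ennreal_toReal).subtype_mk

/-- The conditional distributions of an absolutely continuous law have no atoms. -/
lemma ae_no_atoms {A : Type*} [MeasureSpace A] [SFinite (volume : Measure A)]
    (μ : Measure (A × I)) [IsProbabilityMeasure μ] (hμ : μ ≪ volume) (κ : Kernel A I)
    [IsMarkovKernel κ] (hκ : μ.fst ⊗ₘ κ = μ) : ∀ᵐ z ∂μ.fst, ∀ t, κ z {t} = 0 := by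
  set D : Set (A × I) := {p | κ p.1 {p.2} ≠ 0} with hD
  have hDm : MeasurableSet D :=
    (measurableSet_eq_fun (measurable_kernel_singleton κ) measurable_const).compl
  -- A finite measure has at most countably many atoms, so every section of `D` is Lebesgue null.
  have hvol : (volume : Measure (A × I)) D = 0 := by
    rw [Measure.volume_eq_prod, Measure.measure_prod_null hDm]
    refine Eventually.of_forall fun z => ?_
    have hc : {t | 0 < κ z {a | a = t}}.Countable :=
      Measure.countable_meas_level_set_pos (μ := κ z) measurable_id
    refine (hc.mono fun t ht => ?_).measure_zero _
    exact pos_iff_ne_zero.2 ht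
  have hμD : (μ.fst ⊗ₘ κ) D = 0 := by rw [hκ]; exact hμ hvol
  rw [Measure.compProd_apply hDm, lintegral_eq_zero_iff
    (Kernel.measurable_kernel_prodMk_left hDm)] at hμD
  filter_upwards [hμD] with z hz t
  by_contra ht
  exact ht (measure_mono_null (Set.singleton_subset_iff.2 (show (z, t) ∈ D from ht)) hz)

/-- Under conditional independence of `X` and `Y` given `Z`, the residual `F(Y | Z)` is uniform and
independent of `(X, Z)`. -/
lemma map_residual_eq_prod {Ω A : Type*} [MeasurableSpace Ω] [StandardBorelSpace Ω]
    [MeasurableSpace A] (P : Measure Ω) [IsProbabilityMeasure P] {X Y : Ω → I} {Z : Ω → A}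
    (hX : Measurable X) (hY : Measurable Y) (hZ : Measurable Z)
    (hind : CondIndepFun (MeasurableSpace.comap Z inferInstance) hZ.comap_le X Y P)
    (κ : Kernel A I) [IsMarkovKernel κ]
    (hκ : P.map (fun w => (Z w, Y w)) = P.map Z ⊗ₘ κ) (hatom : ∀ᵐ z ∂P.map Z, ∀ t, κ z {t} = 0) :
    P.map (fun w => ((X w, Z w), distFun (κ (Z w)) (Y w))) =
      (P.map fun w => (X w, Z w)).prod volume := by
  have h1 := (condIndepFun_iff_condDistrib_prod_ae_eq_prodMkRight hY hX hZ).1 hind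
  have h2 := condDistrib_ae_eq_of_measure_eq_compProd Z hY.aemeasurable hκ
  have hZX : Measurable fun w => (Z w, X w) := hZ.prodMk hX
  have hfst : P.map Z = (P.map (fun w => (Z w, X w))).map Prod.fst := by
    rw [Measure.map_map measurable_fst hZX]; rfl
  rw [hfst] at h2 hatom
  have h3 := ae_of_ae_map measurable_fst.aemeasurable h2
  -- Conditional independence in kernel form: the conditional law of `Y` given `(Z, X)` is the one
  -- given `Z` alone.
  have h4 : P.map (fun w => ((Z w, X w), Y w)) =
      P.map (fun w => (Z w, X w)) ⊗ₘ Kernel.prodMkRight I κ := by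
    rw [← condDistrib_ae_eq_iff_measure_eq_compProd _ hY.aemeasurable]
    filter_upwards [h1, h3] with p hp hp'
    rw [hp, Kernel.prodMkRight_apply, Kernel.prodMkRight_apply, hp']
  have hU : Measurable fun w => distFun (κ (Z w)) (Y w) :=
    (measurable_distFun_kernel κ).comp (hZ.prodMk hY)
  have hXZ : Measurable fun w => (X w, Z w) := hX.prodMk hZ
  have : IsProbabilityMeasure (P.map fun w => (X w, Z w)) :=
    Measure.isProbabilityMeasure_map hXZ.aemeasurable
  symm
  refine Measure.prod_eq fun s t hs ht => ?_
  rw [Measure.map_apply (hXZ.prodMk hU) (hs.prod ht), Measure.map_apply hXZ hs]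
  have hs' : MeasurableSet (Prod.swap ⁻¹' s : Set (A × I)) := measurable_swap hs
  have hE : MeasurableSet {p : (A × I) × I | p.1.swap ∈ s ∧ distFun (κ p.1.1) p.2 ∈ t} := by
    refine MeasurableSet.inter (measurable_fst hs') ?_
    exact ((measurable_distFun_kernel κ).comp (measurable_fst.fst.prodMk measurable_snd)) ht
  have hpre : (fun w => ((X w, Z w), distFun (κ (Z w)) (Y w))) ⁻¹' (s ×ˢ t) =
      (fun w => ((Z w, X w), Y w)) ⁻¹'
        {p : (A × I) × I | p.1.swap ∈ s ∧ distFun (κ p.1.1) p.2 ∈ t} := by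
    ext w; simp
  rw [hpre, ← Measure.map_apply (hZX.prodMk hY) hE, h4, Measure.compProd_apply hE]
  -- For fixed `(z, x)` the probability integral transform turns the inner measure into the volume
  -- of `t`, whatever `z` is; this is the independence.
  have h5 : ∀ᵐ p ∂P.map (fun w => (Z w, X w)),
      Kernel.prodMkRight I κ p (Prod.mk p ⁻¹'
        {p : (A × I) × I | p.1.swap ∈ s ∧ distFun (κ p.1.1) p.2 ∈ t}) =
      (Prod.swap ⁻¹' s).indicator (fun _ => volume t) p := by
    have hat := ae_of_ae_map measurable_fst.aemeasurable hatom
    filter_upwards [hat] with p hp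
    by_cases hps : p.swap ∈ s
    · rw [Set.indicator_of_mem (by exact hps), ← map_distFun (κ p.1) hp,
        Measure.map_apply (continuous_distFun _ hp).measurable ht, Kernel.prodMkRight_apply]
      congr 1
      ext u
      simp [hps]
    · rw [Set.indicator_of_notMem (by exact hps)]
      simp [hps]
  rw [lintegral_congr_ae h5, lintegral_indicator hs', setLIntegral_const, mul_comm,
    Measure.map_apply hZX hs']
  rfl

lemma absolutelyContinuous_lawZX {P : Measure (Obs d)} (hP : P ≪ volume) :
    lawZX P ≪ volume := by
  have h : MeasurePreserving (fun w : Obs d => (w.2.2, w.1)) volume volume :=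
    (Measure.measurePreserving_swap (μ := (volume : Measure I)) (ν := (volume : Measure (Cube d)))).comp
      ((MeasurePreserving.id volume).prod
        (measurePreserving_snd (μ := (volume : Measure I)) (ν := (volume : Measure (Cube d)))))
  have := hP.map h.measurable
  rwa [h.map_eq] at this

lemma absolutelyContinuous_lawZY {P : Measure (Obs d)} (hP : P ≪ volume) :
    lawZY P ≪ volume := by
  have h : MeasurePreserving (fun w : Obs d => (w.2.2, w.2.1)) volume volume :=
    (Measure.measurePreserving_swap (μ := (volume : Measure I)) (ν := (volume : Measure (Cube d)))).comp
      (measurePreserving_snd (μ := (volume : Measure I)) (ν := (volume : Measure (I × Cube d))))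
  have := hP.map h.measurable
  rwa [h.map_eq] at this


/-! ### Supports and quantiles -/

lemma IsCorrelationMap.exists_support_bounds {q : ℕ} (hq : 1 ≤ q) {φ : Fin q → I → ℝ}
    (hφ : IsCorrelationMap φ) :
    ∃ a b : I, (a : ℝ) = tauMin φ ∧ (b : ℝ) = tauMax φ ∧ a ≤ b ∧
      (∀ k u, u ≤ a → φ k u = 0) ∧ ∀ k u, b ≤ u → φ k u = 0 := by
  have hcont : ∀ k, Continuous (φ k) := fun k => (hφ.lipschitz k).choose_spec.continuous
  have hcomp : IsCompact (supportUnion φ) :=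
    isCompact_iUnion fun k => (isClosed_tsupport (φ k)).isCompact.image continuous_subtype_val
  have hne : (supportUnion φ).Nonempty := by
    by_contra hemp
    have h0 : φ ⟨0, hq⟩ = 0 := by
      by_contra hne
      obtain ⟨u, hu⟩ := Function.ne_iff.1 hne
      exact hemp ⟨u, Set.mem_iUnion.2 ⟨_, u, subset_tsupport _ hu, rfl⟩⟩
    simpa [h0] using hφ.integral_sq_eq_one ⟨0, hq⟩
  obtain ⟨k₁, a, ha, haeq⟩ := Set.mem_iUnion.1 (hcomp.sInf_mem hne)
  obtain ⟨k₂, b, hb, hbeq⟩ := Set.mem_iUnion.1 (hcomp.sSup_mem hne)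
  have hmem : ∀ k u, φ k u ≠ 0 → (u : ℝ) ∈ supportUnion φ := fun k u hu =>
    Set.mem_iUnion.2 ⟨k, u, subset_tsupport _ hu, rfl⟩
  have hcl : ∀ k, IsClosed {u | φ k u = 0} := fun k => isClosed_eq (hcont k) continuous_const
  refine ⟨a, b, haeq, hbeq, ?_, fun k u hu => ?_, fun k u hu => ?_⟩
  · rw [← Subtype.coe_le_coe]
    exact haeq.le.trans ((Real.sInf_le_sSup _ hcomp.bddBelow hcomp.bddAbove).trans hbeq.ge)
  · have hsub : Set.Iio a ⊆ {u | φ k u = 0} := fun v hv => by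
      by_contra hne'
      have h1 := csInf_le hcomp.bddBelow (hmem k v hne')
      exact absurd (Subtype.coe_le_coe.1 (haeq.le.trans h1)) (not_le.2 hv)
    have := closure_minimal hsub (hcl k)
    -- The supports avoid `0`, so `Iio a` is nonempty and its closure contains `a`: vanishing
    -- extends to the endpoint by continuity.
    rw [closure_Iio' (a := a) ⟨0, (hφ.support_subset k₁ ha).1⟩] at this
    exact this hu
  · have hsub : Set.Ioi b ⊆ {u | φ k u = 0} := fun v hv => by
      by_contra hne'
      have h1 := le_csSup hcomp.bddAbove (hmem k v hne')
      exact absurd (Subtype.coe_le_coe.1 (h1.trans hbeq.ge)) (not_le.2 hv)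
    have := closure_minimal hsub (hcl k)
    rw [closure_Ioi' (a := b) ⟨1, (hφ.support_subset k₂ hb).2⟩] at this
    exact this hu

/-- Continuity makes the superlevel set compact, so the quantile is attained; the value there cannot
exceed `τ`, as the intermediate value theorem would give an earlier point. -/
lemma exists_eq_sInf_of_continuous {f : I → I} (hc : Continuous f)
    (h0 : f 0 = 0) (h1 : f 1 = 1) (τ : I) :
    ∃ t : I, (t : ℝ) = sInf {s : ℝ | ∃ hs : s ∈ I, (τ : ℝ) ≤ f ⟨s, hs⟩} ∧ f t = τ ∧
      ∀ s, τ ≤ f s → t ≤ s := by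
  have hne : (f ⁻¹' Set.Ici τ).Nonempty := ⟨1, by simp [h1, unitInterval.le_one']⟩
  obtain ⟨t, ht, hmin⟩ := (isClosed_Ici.preimage hc).isCompact.exists_isLeast hne
  obtain ⟨s, hs⟩ := intermediate_value_univ 0 1 hc
    (show τ ∈ Set.Icc (f 0) (f 1) by
      rw [h0, h1]; exact ⟨unitInterval.nonneg', unitInterval.le_one'⟩)
  have hleast : IsLeast {s : ℝ | ∃ hs : s ∈ I, (τ : ℝ) ≤ f ⟨s, hs⟩} t :=
    ⟨⟨t.2, ht⟩, fun s ⟨hs, hle⟩ => hmin (show τ ≤ f ⟨s, hs⟩ from hle)⟩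
  refine ⟨t, hleast.csInf_eq.symm, ?_, fun s hs => hmin hs⟩
  by_contra hne'
  -- between `0` and `t` the value `τ` would be attained earlier
  have hlt : τ < f t := lt_of_le_of_ne ht (Ne.symm hne')
  obtain ⟨r, hr, hr'⟩ := intermediate_value_Icc (unitInterval.nonneg' : (0 : I) ≤ t)
    hc.continuousOn (show τ ∈ Set.Icc (f 0) (f t) by
      rw [h0]; exact ⟨unitInterval.nonneg', ht⟩)
  have : r = t := le_antisymm hr.2 (hmin hr'.ge)
  exact hlt.ne (this ▸ hr'.symm)

/-- A uniform approximation of `f` by a monotone `e` on the part `[f⁻¹ a, f⁻¹ b]` controls the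
error of `ψ ∘ e` everywhere when `ψ` vanishes outside `[a, b]`. -/
lemma abs_comp_sub_comp_le {ψ : I → ℝ} {L : NNReal} (hψ : LipschitzWith L ψ) {a b : I}
    (ha : ∀ u, u ≤ a → ψ u = 0) (hb : ∀ u, b ≤ u → ψ u = 0) {f e : I → I}
    (hfm : Monotone f) (hem : Monotone e) {s t : I} (hst : s ≤ t) (hs : f s = a) (ht : f t = b)
    {r : ℝ} (hr : ∀ u, s ≤ u → u ≤ t → |(f u : ℝ) - e u| ≤ r) (u : I) :
    |ψ (e u) - ψ (f u)| ≤ L * r := by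
  have hL : ∀ x y : I, |ψ x - ψ y| ≤ L * |(x : ℝ) - y| := fun x y => by
    simpa [Real.dist_eq, Subtype.dist_eq] using hψ.dist_le_mul x y
  have hr0 : 0 ≤ r := (abs_nonneg _).trans (hr s le_rfl hst)
  have hLr : 0 ≤ (L : ℝ) * r := mul_nonneg L.2 hr0
  rcases lt_or_ge u s with hus | hus
  · rw [ha (f u) (hs ▸ hfm hus.le), sub_zero]
    rcases le_total (e u) a with h | h
    · simpa [ha _ h] using hLr
    -- Here `a ≤ e u ≤ e s ≤ a + r`, so `e u` lies within `r` of a zero of `ψ`. The case to the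
    -- right of `t` mirrors this.
    · have h1 : (e u : ℝ) ≤ e s := hem hus.le
      have h2 := abs_le.1 (hr s le_rfl hst)
      have h3 : (a : ℝ) ≤ e u := h
      rw [hs] at h2
      have := hL (e u) a
      rw [ha a le_rfl, sub_zero, abs_of_nonneg (by linarith : (0 : ℝ) ≤ e u - a)] at this
      exact this.trans (mul_le_mul_of_nonneg_left (by linarith) L.2)
  rcases lt_or_ge t u with hut | hut
  · rw [hb (f u) (ht ▸ hfm hut.le), sub_zero]
    rcases le_total b (e u) with h | h
    · simpa [hb _ h] using hLr
    · have h1 : (e t : ℝ) ≤ e u := hem hut.le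
      have h2 := abs_le.1 (hr t hst le_rfl)
      have h3 : (e u : ℝ) ≤ b := h
      rw [ht] at h2
      have := hL (e u) b
      rw [hb b le_rfl, sub_zero, abs_of_nonpos (by linarith : (e u : ℝ) - b ≤ 0)] at this
      exact this.trans (mul_le_mul_of_nonneg_left (by linarith) L.2)
  · refine (hL _ _).trans (mul_le_mul_of_nonneg_left ?_ L.2)
    rw [abs_sub_comm]
    exact hr u hus hut

lemma abs_le_of_supOver_le {d : ℕ} {S : Cube d → Set I} {f : Cube d → I → ℝ} {r : ℝ} (hr : 0 ≤ r)
    (h : supOver S f ≤ ENNReal.ofReal r) (z : Cube d) {t : I} (ht : t ∈ S z) : |f z t| ≤ r :=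
  (ENNReal.ofReal_le_ofReal_iff hr).1 <|
    (le_iSup_of_le z (le_iSup₂ (f := fun t _ => ENNReal.ofReal |f z t|) t ht)).trans h

/-- Uniform consistency over the conditional quantiles controls the error of the transformed
residuals everywhere. -/
lemma abs_residual_error_le {q d : ℕ} {φ : Fin q → I → ℝ} {a b : I} (ha : (a : ℝ) = tauMin φ)
    (hb : (b : ℝ) = tauMax φ) (hab : a ≤ b) {ψ : I → ℝ} {L : NNReal} (hψ : LipschitzWith L ψ)
    (hψa : ∀ u, u ≤ a → ψ u = 0) (hψb : ∀ u, b ≤ u → ψ u = 0) (κ : Kernel (Cube d) I)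
    [IsMarkovKernel κ] {F : Cube d → I → ℝ} (hF : ∀ z t, F z t = (κ z).real (Set.Iic t))
    {e : Cube d → I → I} (he : ∀ z, Monotone (e z)) {r : ℝ} (hr : 0 ≤ r)
    (hsup : supOver (quantileRange φ F) (fun z t => F z t - e z t) ≤ ENNReal.ofReal r)
    {z : Cube d} (hz : ∀ t, κ z {t} = 0) (t : I) :
    |ψ (e z t) - ψ (distFun (κ z) t)| ≤ L * r := by
  have hFd : ∀ z t, F z t = distFun (κ z) t := hF
  have hq : ∀ τ : I, ∃ t : I, (t : ℝ) = condQuantile F τ z ∧ distFun (κ z) t = τ ∧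
      ∀ s, τ ≤ distFun (κ z) s → t ≤ s := fun τ => by
    have := exists_eq_sInf_of_continuous (continuous_distFun (κ z) hz)
      (distFun_zero _ (hz 0)) (distFun_one _) τ
    simpa only [condQuantile, hFd] using this
  obtain ⟨s₁, hs₁, hs₁', hmin⟩ := hq a
  obtain ⟨s₂, hs₂, hs₂', -⟩ := hq b
  refine abs_comp_sub_comp_le hψ hψa hψb (monotone_distFun (κ z)) (he z)
    (hmin _ (hab.trans hs₂'.ge)) hs₁' hs₂' (fun u hu₁ hu₂ => ?_) t
  have hu : u ∈ quantileRange φ F z := by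
    refine ⟨?_, ?_⟩
    · rw [← ha, ← hs₁]; exact hu₁
    · rw [← hb, ← hs₂]; exact hu₂
  simpa only [hFd] using abs_le_of_supOver_le hr hsup z hu


/-! ### Convergence to zero in probability of statistics of i.i.d. samples -/

variable {E A B : Type*} [MeasurableSpace E] [MeasurableSpace A] [MeasurableSpace B]

/-- The statistic `X n` of an `n`-sample from `P` tends to zero in probability. -/
def VanishesInProb (P : Measure E) (X : (n : ℕ) → (Fin n → E) → ℝ) : Prop :=
  ∀ δ : ℝ, 0 < δ →
    Tendsto (fun n => (Measure.pi fun _ : Fin n => P).real {w | δ ≤ |X n w|}) atTop (𝓝 0)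

lemma VanishesInProb.add {P : Measure E} [IsProbabilityMeasure P]
    {X Y : (n : ℕ) → (Fin n → E) → ℝ} (hX : VanishesInProb P X) (hY : VanishesInProb P Y) :
    VanishesInProb P fun n w => X n w + Y n w := by
  intro δ hδ
  have h := (hX (δ / 2) (half_pos hδ)).add (hY (δ / 2) (half_pos hδ))
  rw [add_zero] at h
  refine squeeze_zero (fun _ => measureReal_nonneg) (fun n => ?_) h
  refine (measureReal_mono ?_).trans (measureReal_union_le _ _)
  intro w hw
  by_contra hcon
  simp only [Set.mem_union, Set.mem_ofPred_eq, not_or, not_le] at hcon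
  have hw' : δ ≤ |X n w + Y n w| := hw
  linarith [abs_add_le (X n w) (Y n w), hcon.1, hcon.2]

/-- `max_i |H n i|` is stochastically bounded by the sequence `g`. -/
def UniformlyBoundedInProb (P : Measure E) (H : (n : ℕ) → (Fin n → E) → Fin n → ℝ)
    (g : ℕ → ℝ) : Prop :=
  ∀ ε : ℝ, 0 < ε → ∃ M : ℝ, 0 < M ∧ ∀ n : ℕ, 1 ≤ n →
    (Measure.pi fun _ : Fin n => P).real {w | ∃ i, M * |g n| < |H n w i|} ≤ ε

/-- The product of two errors whose rates multiply to `o(n^(-1/2))` is negligible. -/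
lemma vanishesInProb_mul {P : Measure E} [IsProbabilityMeasure P]
    {H K : (n : ℕ) → (Fin n → E) → Fin n → ℝ} {g h : ℕ → ℝ}
    (hH : UniformlyBoundedInProb P H g) (hK : UniformlyBoundedInProb P K h)
    (hgh : Tendsto (fun n : ℕ => Real.sqrt n * g n * h n) atTop (𝓝 0)) :
    VanishesInProb P fun n w => (Real.sqrt n)⁻¹ * ∑ i, H n w i * K n w i := by
  intro δ hδ
  rw [Metric.tendsto_atTop]
  intro ε hε
  -- Two exceptional events of probability at most `ε / 3` leave a strict inequality below `ε`.
  obtain ⟨M, hM, hHM⟩ := hH (ε / 3) (by positivity)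
  obtain ⟨N, hN, hKN⟩ := hK (ε / 3) (by positivity)
  have hsmall : Tendsto (fun n : ℕ => M * N * |Real.sqrt n * g n * h n|) atTop (𝓝 0) := by
    simpa using hgh.abs.const_mul (M * N)
  obtain ⟨n₀, hn₀⟩ := eventually_atTop.1 (hsmall.eventually (gt_mem_nhds hδ))
  refine ⟨max n₀ 1, fun n hn => ?_⟩
  have hn1 : 1 ≤ n := (le_max_right _ _).trans hn
  have hnn := hn₀ n ((le_max_left _ _).trans hn)
  rw [Real.dist_eq, sub_zero, abs_of_nonneg measureReal_nonneg]
  have hsub : {w : Fin n → E | δ ≤ |(Real.sqrt n)⁻¹ * ∑ i, H n w i * K n w i|} ⊆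
      {w | ∃ i, M * |g n| < |H n w i|} ∪ {w | ∃ i, N * |h n| < |K n w i|} := by
    intro w hw
    by_contra hcon
    simp only [Set.mem_union, Set.mem_ofPred_eq, not_or, not_exists, not_lt] at hcon
    have hsum : |∑ i, H n w i * K n w i| ≤ n * (M * |g n| * (N * |h n|)) := by
      refine (Finset.abs_sum_le_sum_abs _ _).trans ?_
      have : ∀ i ∈ Finset.univ, |H n w i * K n w i| ≤ M * |g n| * (N * |h n|) := fun i _ => by
        rw [abs_mul]
        exact mul_le_mul (hcon.1 i) (hcon.2 i) (abs_nonneg _) (by positivity)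
      simpa using Finset.sum_le_card_nsmul _ _ _ this
    have hs : 0 < Real.sqrt n := Real.sqrt_pos.2 (by exact_mod_cast hn1)
    have hw' : δ ≤ |(Real.sqrt n)⁻¹ * ∑ i, H n w i * K n w i| := hw
    rw [abs_mul, abs_of_pos (inv_pos.2 hs)] at hw'
    have h2 : (Real.sqrt n)⁻¹ * (n * (M * |g n| * (N * |h n|))) =
        M * N * |Real.sqrt n * g n * h n| := by
      rw [abs_mul, abs_mul, abs_of_pos hs]
      nth_rewrite 2 [← Real.mul_self_sqrt (Nat.cast_nonneg n)]
      field_simp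
    have h3 := mul_le_mul_of_nonneg_left hsum (inv_pos.2 hs).le
    linarith
  have := (measureReal_mono (μ := Measure.pi fun _ : Fin n => P) hsub).trans
    (measureReal_union_le _ _)
  linarith [hHM n hn1, hKN n hn1]

/-- The second moment of a weighted sum of independent standardized variables. -/
lemma integral_sq_sum_mul {n : ℕ} {Q : Measure B} [IsProbabilityMeasure Q] {η : B → ℝ}
    (hη : MemLp η 2 Q) (h0 : ∫ u, η u ∂Q = 0) (h1 : ∫ u, η u ^ 2 ∂Q = 1) (c : Fin n → ℝ) :
    ∫ u, (∑ i, c i * η (u i)) ^ 2 ∂(Measure.pi fun _ : Fin n => Q) = ∑ i, c i ^ 2 := by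
  set μ := Measure.pi fun _ : Fin n => Q
  have hmp : ∀ i, MeasurePreserving (Function.eval i) μ Q := fun i =>
    measurePreserving_eval (fun _ : Fin n => Q) i
  have hX : ∀ i, MemLp (fun u : Fin n → B => c i * η (u i)) 2 μ := fun i =>
    (hη.comp_measurePreserving (hmp i)).const_mul (c i)
  have hind : iIndepFun (fun i (u : Fin n → B) => c i * η (u i)) μ :=
    iIndepFun_pi (X := fun i (x : B) => c i * η x)
      fun i => (hη.aestronglyMeasurable.aemeasurable).const_mul _
  have hmean : ∀ i, ∫ u, c i * η (u i) ∂μ = 0 := fun i => by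
    rw [integral_const_mul]
    have := integral_comp_eval (μ := fun _ : Fin n => Q) (i := i) (f := η) hη.aestronglyMeasurable
    rw [this, h0, mul_zero]
  have hsum0 : ∫ u, (∑ i, fun u : Fin n → B => c i * η (u i)) u ∂μ = 0 := by
    simp only [Finset.sum_apply]
    rw [integral_finsetSum _ fun i _ => (hX i).integrable (by norm_num)]
    simp [hmean]
  -- All means vanish, so second moments are variances, and these add over independent terms.
  have hvar := IndepFun.variance_sum (s := Finset.univ) (fun i _ => hX i)
    (fun i _ j _ hij => hind.indepFun hij)
  rw [variance_of_integral_eq_zero (memLp_finsetSum' _ fun i _ => hX i).aestronglyMeasurable.aemeasurable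
    hsum0] at hvar
  simp only [Finset.sum_apply] at hvar
  rw [hvar]
  refine Finset.sum_congr rfl fun i _ => ?_
  rw [variance_of_integral_eq_zero (hX i).aestronglyMeasurable.aemeasurable (hmean i)]
  simp only [mul_pow]
  rw [integral_const_mul]
  have := integral_comp_eval (μ := fun _ : Fin n => Q) (i := i) (f := fun u => η u ^ 2)
    (hη.aestronglyMeasurable.pow 2)
  rw [this, h1, mul_one]

/-- If `(p, v)` has a product law, so does the pair of samples. -/
lemma measurePreserving_sample {P : Measure E} [IsProbabilityMeasure P] {Q : Measure B}
    [IsProbabilityMeasure Q] {p : E → A} {v : E → B} (hp : Measurable p) (hv : Measurable v)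
    (hprod : P.map (fun x => (p x, v x)) = (P.map p).prod Q) (n : ℕ) :
    MeasurePreserving (fun w : Fin n → E => ((fun i => p (w i)), fun i => v (w i)))
      (Measure.pi fun _ : Fin n => P)
      ((Measure.pi fun _ : Fin n => P.map p).prod (Measure.pi fun _ : Fin n => Q)) := by
  have : IsProbabilityMeasure (P.map p) := Measure.isProbabilityMeasure_map hp.aemeasurable
  have h1 : MeasurePreserving (fun x => (p x, v x)) P ((P.map p).prod Q) :=
    ⟨hp.prodMk hv, hprod⟩
  exact (measurePreserving_arrowProdEquivProdArrow A B (Fin n) (fun _ => P.map p)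
    (fun _ => Q)).comp (measurePreserving_pi (fun _ : Fin n => P) _ fun _ => h1)

/-- By Fubini, the sample of `p` can be frozen: the weights `H` become constants and the cross terms
vanish. Boundedness supplies integrability. -/
lemma integral_sq_sum_mul_residual {n : ℕ} {P : Measure E} [IsProbabilityMeasure P] {Q : Measure B}
    [IsProbabilityMeasure Q] {p : E → A} {v : E → B} (hp : Measurable p) (hv : Measurable v)
    (hprod : P.map (fun x => (p x, v x)) = (P.map p).prod Q) {η : B → ℝ} (hηm : Measurable η)
    {K : ℝ} (hK : ∀ u, |η u| ≤ K) (h0 : ∫ u, η u ∂Q = 0) (h1 : ∫ u, η u ^ 2 ∂Q = 1)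
    {H : (Fin n → A) → Fin n → ℝ} (hH : ∀ i, Measurable fun s => H s i) {C : ℝ}
    (hC : ∀ s i, |H s i| ≤ C) :
    ∫ w, (∑ i, H (fun j => p (w j)) i * η (v (w i))) ^ 2 ∂(Measure.pi fun _ : Fin n => P) =
      ∫ w, ∑ i, H (fun j => p (w j)) i ^ 2 ∂(Measure.pi fun _ : Fin n => P) := by
  have hP : IsProbabilityMeasure (P.map p) := Measure.isProbabilityMeasure_map hp.aemeasurable
  have hmp := measurePreserving_sample hp hv hprod n
  set μ := Measure.pi fun _ : Fin n => P
  set μA := Measure.pi fun _ : Fin n => P.map p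
  set μB := Measure.pi fun _ : Fin n => Q
  set f : (Fin n → A) × (Fin n → B) → ℝ := fun x => (∑ i, H x.1 i * η (x.2 i)) ^ 2 with hf
  have hfm : Measurable f := by
    refine Measurable.pow_const (Finset.measurable_fun_sum _ fun i _ => ?_) 2
    exact ((hH i).comp measurable_fst).mul
      (hηm.comp ((measurable_pi_apply i).comp measurable_snd))
  have hfb : ∀ x, ‖f x‖ ≤ (∑ _i : Fin n, C * K) ^ 2 := fun x => by
    rw [hf, norm_pow, Real.norm_eq_abs]
    refine pow_le_pow_left₀ (abs_nonneg _) ((Finset.abs_sum_le_sum_abs _ _).trans ?_) 2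
    refine Finset.sum_le_sum fun i _ => ?_
    rw [abs_mul]
    exact mul_le_mul (hC _ _) (hK _) (abs_nonneg _) ((abs_nonneg _).trans (hC x.1 i))
  have hint : Integrable f (μA.prod μB) :=
    .of_bound hfm.aestronglyMeasurable _ (Eventually.of_forall hfb)
  have hηL : MemLp η 2 Q :=
    .of_bound hηm.aestronglyMeasurable K (Eventually.of_forall hK)
  calc ∫ w, (∑ i, H (fun j => p (w j)) i * η (v (w i))) ^ 2 ∂μ
      = ∫ x, f x ∂(μA.prod μB) := by
        rw [← hmp.map_eq, integral_map hmp.measurable.aemeasurable hfm.aestronglyMeasurable]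
    _ = ∫ s, ∑ i, H s i ^ 2 ∂μA := by
        rw [integral_prod _ hint]
        refine integral_congr_ae (Eventually.of_forall fun s => ?_)
        exact integral_sq_sum_mul hηL h0 h1 (H s)
    _ = ∫ w, ∑ i, H (fun j => p (w j)) i ^ 2 ∂μ := by
        have hmpA : MeasurePreserving (fun (w : Fin n → E) j => p (w j)) μ μA :=
          measurePreserving_pi (fun _ : Fin n => P) _ fun _ => hp.measurePreserving P
        rw [← hmpA.map_eq, integral_map hmpA.measurable.aemeasurable]
        exact (Finset.measurable_fun_sum _ fun i _ => (hH i).pow_const 2).aestronglyMeasurable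

/-- A uniformly vanishing error that is a function of the sample `p`, weighted by independent
standardized variables, is negligible at the rate `n^(-1/2)`. -/
lemma vanishesInProb_sum_mul_residual {P : Measure E} [IsProbabilityMeasure P] {Q : Measure B}
    [IsProbabilityMeasure Q] {p : E → A} {v : E → B} (hp : Measurable p) (hv : Measurable v)
    (hprod : P.map (fun x => (p x, v x)) = (P.map p).prod Q) {η : B → ℝ} (hηm : Measurable η)
    {K : ℝ} (hK : ∀ u, |η u| ≤ K) (h0 : ∫ u, η u ∂Q = 0) (h1 : ∫ u, η u ^ 2 ∂Q = 1)
    {H : (n : ℕ) → (Fin n → A) → Fin n → ℝ} (hH : ∀ n i, Measurable fun s => H n s i) {C : ℝ}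
    (hC : ∀ n s i, |H n s i| ≤ C) {g : ℕ → ℝ} (hg : Tendsto g atTop (𝓝 0))
    (hHg : UniformlyBoundedInProb P (fun n w => H n fun j => p (w j)) g) :
    VanishesInProb P fun n w =>
      (Real.sqrt n)⁻¹ * ∑ i, H n (fun j => p (w j)) i * η (v (w i)) := by
  intro δ hδ
  rw [Metric.tendsto_atTop]
  intro ε hε
  -- Chosen so that `C ^ 2` times the probability of the bad event is at most `ε * δ ^ 2 / 4`; the
  -- `+ 1` guards against `C = 0`. With the same bound on the good event, Chebyshev gives a
  -- probability below `ε`.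
  obtain ⟨M, hM, hHM⟩ := hHg (ε * δ ^ 2 / (4 * (C ^ 2 + 1))) (by positivity)
  have hsmall : Tendsto (fun n : ℕ => (M * |g n|) ^ 2) atTop (𝓝 0) := by
    simpa using (hg.abs.const_mul M).pow 2
  obtain ⟨n₀, hn₀⟩ := eventually_atTop.1
    (hsmall.eventually (gt_mem_nhds (show 0 < ε * δ ^ 2 / 4 by positivity)))
  refine ⟨max n₀ 1, fun n hn => ?_⟩
  have hn1 : 1 ≤ n := (le_max_right _ _).trans hn
  have hnn := hn₀ n ((le_max_left _ _).trans hn)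
  have hbad := hHM n hn1
  have hnpos : (0 : ℝ) < n := by exact_mod_cast hn1
  rw [Real.dist_eq, sub_zero, abs_of_nonneg measureReal_nonneg]
  set μ := Measure.pi fun _ : Fin n => P
  set bad : Set (Fin n → E) := {w | ∃ i, M * |g n| < |H n (fun j => p (w j)) i|} with hbad_def
  have hpm : Measurable fun (w : Fin n → E) j => p (w j) :=
    measurable_pi_lambda _ fun j => hp.comp (measurable_pi_apply j)
  have hHm : ∀ i, Measurable fun w : Fin n → E => H n (fun j => p (w j)) i := fun i =>
    (hH n i).comp hpm
  have hbm : MeasurableSet bad := by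
    rw [hbad_def, Set.ofPred_exists]
    exact MeasurableSet.iUnion fun i => measurableSet_lt measurable_const
      (continuous_abs.measurable.comp (hHm i))
  have hmean : ∫ w, ∑ i, H n (fun j => p (w j)) i ^ 2 ∂μ ≤
      n * ((M * |g n|) ^ 2 + C ^ 2 * μ.real bad) := by
    have hpt : ∀ w, ∑ i, H n (fun j => p (w j)) i ^ 2 ≤
        n * ((M * |g n|) ^ 2 + bad.indicator (fun _ => C ^ 2) w) := fun w => by
      have hterm : ∀ i ∈ Finset.univ, H n (fun j => p (w j)) i ^ 2 ≤
          (M * |g n|) ^ 2 + bad.indicator (fun _ => C ^ 2) w := fun i _ => by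
        rw [← sq_abs]
        by_cases hw : w ∈ bad
        · rw [Set.indicator_of_mem hw]
          have := pow_le_pow_left₀ (abs_nonneg _) (hC n (fun j => p (w j)) i) 2
          linarith [sq_nonneg (M * |g n|)]
        · rw [Set.indicator_of_notMem hw, add_zero]
          refine pow_le_pow_left₀ (abs_nonneg _) (not_lt.1 fun h => hw ⟨i, h⟩) 2
      simpa [mul_add] using Finset.sum_le_card_nsmul _ _ _ hterm
    have hind : Integrable (bad.indicator fun _ => C ^ 2) μ :=
      (integrable_const _).indicator hbm
    refine (integral_mono ?_ (((integrable_const _).add hind).const_mul _) hpt).trans (le_of_eq ?_)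
    · refine integrable_finsetSum _ fun i _ => ?_
      refine .of_bound ((hHm i).pow_const 2).aestronglyMeasurable (C ^ 2)
        (Eventually.of_forall fun w => ?_)
      rw [norm_pow, Real.norm_eq_abs]
      exact pow_le_pow_left₀ (abs_nonneg _) (hC _ _ _) 2
    · simp only [Pi.add_apply]
      rw [integral_const_mul, integral_add (integrable_const _) hind, integral_indicator hbm]
      simp [mul_comm]
  set X : (Fin n → E) → ℝ :=
    fun w => ((Real.sqrt n)⁻¹ * ∑ i, H n (fun j => p (w j)) i * η (v (w i))) ^ 2 with hX
  have hXint : Integrable X μ := by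
    refine .of_bound (C := ((Real.sqrt n)⁻¹ * ∑ _i : Fin n, C * K) ^ 2) ?_
      (Eventually.of_forall fun w => ?_)
    · refine (Measurable.pow_const (Measurable.const_mul
        (Finset.measurable_fun_sum _ fun i _ => ?_) _) 2).aestronglyMeasurable
      exact (hHm i).mul (hηm.comp (hv.comp (measurable_pi_apply i)))
    · rw [hX, norm_pow, Real.norm_eq_abs, abs_mul, abs_of_nonneg (by positivity :
        (0 : ℝ) ≤ (Real.sqrt n)⁻¹)]
      refine pow_le_pow_left₀ (by positivity) (mul_le_mul_of_nonneg_left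
        ((Finset.abs_sum_le_sum_abs _ _).trans ?_) (by positivity)) 2
      refine Finset.sum_le_sum fun i _ => ?_
      rw [abs_mul]
      exact mul_le_mul (hC _ _ _) (hK _) (abs_nonneg _)
        ((abs_nonneg _).trans (hC n (fun j => p (w j)) i))
  have hXI : ∫ w, X w ∂μ ≤ (M * |g n|) ^ 2 + C ^ 2 * μ.real bad := by
    simp only [hX, mul_pow, inv_pow, Real.sq_sqrt hnpos.le]
    rw [integral_const_mul,
      integral_sq_sum_mul_residual hp hv hprod hηm hK h0 h1 (hH n) (hC n)]
    rw [inv_mul_le_iff₀ hnpos]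
    simpa only [mul_pow] using hmean
  have hcheb := mul_meas_ge_le_integral_of_nonneg
    (Eventually.of_forall fun w => sq_nonneg _ : 0 ≤ᵐ[μ] X) hXint (δ ^ 2)
  have hset : {w | δ ^ 2 ≤ X w} =
      {w | δ ≤ |(Real.sqrt n)⁻¹ * ∑ i, H n (fun j => p (w j)) i * η (v (w i))|} := by
    ext w
    simp only [hX, Set.mem_ofPred_eq]
    rw [sq_le_sq, abs_of_pos hδ]
  rw [hset] at hcheb
  have hb2 : C ^ 2 * μ.real bad ≤ ε * δ ^ 2 / 4 := by
    calc C ^ 2 * μ.real bad ≤ (C ^ 2 + 1) * (ε * δ ^ 2 / (4 * (C ^ 2 + 1))) :=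
          mul_le_mul (by linarith) hbad measureReal_nonneg (by positivity)
      _ = ε * δ ^ 2 / 4 := by field_simp
  have hfin : δ ^ 2 * μ.real {w | δ ≤
      |(Real.sqrt n)⁻¹ * ∑ i, H n (fun j => p (w j)) i * η (v (w i))|} < δ ^ 2 * ε := by
    have : 0 < δ ^ 2 * ε := by positivity
    linarith
  exact lt_of_mul_lt_mul_left hfin (by positivity)


/-! ### The multivariate central limit theorem and quadratic statistics -/

/-- Convergence in distribution depends only on the laws. -/
lemma _root_.MeasureTheory.TendstoInDistribution.of_map_eq {T Ω₁ Ω₂ : Type*} {Ω Ω' : T → Type*}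
    [∀ i, MeasurableSpace (Ω i)] [∀ i, MeasurableSpace (Ω' i)] [MeasurableSpace Ω₁]
    [MeasurableSpace Ω₂] {V : Type*} [TopologicalSpace V] [MeasurableSpace V]
    [OpensMeasurableSpace V] {μ : ∀ i, Measure (Ω i)} {ν : ∀ i, Measure (Ω' i)}
    [∀ i, IsProbabilityMeasure (μ i)] [∀ i, IsProbabilityMeasure (ν i)] {μ₁ : Measure Ω₁}
    {ν₁ : Measure Ω₂} [IsProbabilityMeasure μ₁] [IsProbabilityMeasure ν₁] {l : Filter T}
    {X : ∀ i, Ω i → V} {Y : ∀ i, Ω' i → V} {Z : Ω₁ → V} {Z' : Ω₂ → V}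
    (h : TendstoInDistribution X l Z μ μ₁) (hY : ∀ i, AEMeasurable (Y i) (ν i))
    (hZ' : AEMeasurable Z' ν₁) (hmap : ∀ i, (ν i).map (Y i) = (μ i).map (X i))
    (hlim : ν₁.map Z' = μ₁.map Z) : TendstoInDistribution Y l Z' ν ν₁ where
  forall_aemeasurable := hY
  aemeasurable_limit := hZ'
  tendsto := by
    have := h.tendsto
    simp only [← hmap, ← hlim] at this
    exact this

section CentralLimit

variable {E ι : Type*} [MeasurableSpace E] [Fintype ι]

/-- The normalized sums of i.i.d. bounded, centred, orthonormal variables are asymptotically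
standard Gaussian. -/
theorem tendstoInDistribution_stdGaussian (P : Measure E) [IsProbabilityMeasure P]
    {W : ι → E → ℝ} (hW : ∀ j, Measurable (W j)) {C : ℝ} (hC : ∀ j x, |W j x| ≤ C)
    (h0 : ∀ j, ∫ x, W j x ∂P = 0)
    (h1 : ∀ j, ∫ x, W j x ^ 2 ∂P = 1) (h2 : ∀ j k, j ≠ k → ∫ x, W j x * W k x ∂P = 0) :
    TendstoInDistribution (fun (n : ℕ) (ω : ℕ → E) => WithLp.toLp 2 fun j =>
        (Real.sqrt n)⁻¹ * ∑ i ∈ Finset.range n, W j (ω i))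
      atTop (id : EuclideanSpace ℝ ι → EuclideanSpace ℝ ι)
      (fun _ => Measure.infinitePi fun _ : ℕ => P) (stdGaussian (EuclideanSpace ℝ ι)) := by
  classical
  set μ := Measure.infinitePi fun _ : ℕ => P
  have hVm : ∀ n : ℕ, Measurable fun ω : ℕ → E => (WithLp.toLp 2 fun j =>
      (Real.sqrt n)⁻¹ * ∑ i ∈ Finset.range n, W j (ω i) : EuclideanSpace ℝ ι) := fun n => by
    refine (WithLp.measurable_toLp 2 _).comp (measurable_pi_lambda _ fun j => ?_)
    exact (Finset.measurable_fun_sum _ fun i _ => (hW j).comp (measurable_pi_apply i)).const_mul _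
  refine ⟨fun n => (hVm n).aemeasurable, aemeasurable_id, ?_⟩
  refine ProbabilityMeasure.tendsto_iff_tendsto_charFun.2 fun t => ?_
  simp only [ProbabilityMeasure.coe_mk, Measure.map_id, charFun_stdGaussian]
  -- The Cramér–Wold device: the characteristic function at `t` is that of the scalar sum of the
  -- projections `Y`, evaluated at `1`.
  set Y : E → ℝ := fun x => ∑ j, t j * W j x with hY
  have hYm : Measurable Y := Finset.measurable_fun_sum _ fun j _ => (hW j).const_mul _
  have hWint : ∀ j k, Integrable (fun x => W j x * W k x) P := fun j k =>
    .of_bound ((hW j).mul (hW k)).aestronglyMeasurable (C * C) (Eventually.of_forall fun x => by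
      rw [norm_mul]
      exact mul_le_mul (hC _ _) (hC _ _) (norm_nonneg _) ((abs_nonneg _).trans (hC j x)))
  have hYL : MemLp Y 2 P :=
    memLp_finsetSum _ fun j _ => (MemLp.of_bound (hW j).aestronglyMeasurable C
      (Eventually.of_forall (hC j))).const_mul _
  have hY0 : ∫ x, Y x ∂P = 0 := by
    rw [hY, integral_finsetSum]
    · simp [integral_const_mul, h0]
    · exact fun j _ => (Integrable.of_bound (hW j).aestronglyMeasurable C
        (Eventually.of_forall (hC j))).const_mul _
  have hY2 : ∫ x, Y x ^ 2 ∂P = ‖t‖ ^ 2 := by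
    have hexp : ∀ x, Y x ^ 2 = ∑ j, ∑ k, t j * t k * (W j x * W k x) := fun x => by
      rw [hY, sq, Finset.sum_mul_sum]
      exact Finset.sum_congr rfl fun j _ => Finset.sum_congr rfl fun k _ => by ring
    simp only [hexp]
    rw [integral_finsetSum _ fun j _ => integrable_finsetSum _ fun k _ => (hWint j k).const_mul _]
    rw [EuclideanSpace.norm_sq_eq]
    refine Finset.sum_congr rfl fun j _ => ?_
    rw [integral_finsetSum _ fun k _ => (hWint j k).const_mul _, Finset.sum_eq_single j]
    · rw [integral_const_mul, Real.norm_eq_abs, sq_abs]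
      simp only [← sq, h1, mul_one]
    · intro k _ hk
      rw [integral_const_mul, h2 j k (Ne.symm hk), mul_zero]
    · simp
  have hev : ∀ i, MeasurePreserving (fun ω : ℕ → E => ω i) μ P := fun i =>
    measurePreserving_eval_infinitePi (fun _ : ℕ => P) i
  have hint : ∀ f : E → ℝ, Measurable f → ∫ ω, f (ω 0) ∂μ = ∫ x, f x ∂P := fun f hf => by
    rw [← (hev 0).map_eq, integral_map (hev 0).measurable.aemeasurable hf.aestronglyMeasurable]
  have hvar : Var[fun ω : ℕ → E => Y (ω 0); μ] = ‖t‖ ^ 2 := by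
    rw [variance_of_integral_eq_zero (X := fun ω : ℕ → E => Y (ω 0))
      (hYm.comp (hev 0).measurable).aemeasurable ((hint Y hYm).trans hY0), hint (fun x => Y x ^ 2) (hYm.pow_const 2), hY2]
  have hclt := (tendstoInDistribution_inv_sqrt_mul_sum_sub (P := μ)
    (P' := gaussianReal 0 (‖t‖ ^ 2).toNNReal) (Y := id) (X := fun i ω => Y (ω i))
    ⟨aemeasurable_id, by rw [Measure.map_id, hvar]⟩ (hYL.comp_measurePreserving (hev 0))
    (iIndepFun_infinitePi (P := fun _ : ℕ => P) (X := fun _ => Y) fun _ => hYm)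
    fun i => ⟨(hYm.comp (hev i).measurable).aemeasurable, (hYm.comp (hev 0).measurable).aemeasurable,
      by
        have hi := Measure.map_map hYm (hev i).measurable (μ := μ)
        have h0 := Measure.map_map hYm (hev 0).measurable (μ := μ)
        rw [(hev i).map_eq] at hi
        rw [(hev 0).map_eq] at h0
        exact hi.symm.trans h0⟩).tendsto
  have hlim := ProbabilityMeasure.tendsto_iff_tendsto_charFun.1 hclt 1
  simp only [ProbabilityMeasure.coe_mk, Measure.map_id, charFun_gaussianReal] at hlim
  convert hlim using 1
  · funext n
    have hSm : Measurable fun ω : ℕ → E => (Real.sqrt n)⁻¹ *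
        (∑ i ∈ Finset.range n, Y (ω i) - n * ∫ ω, Y (ω 0) ∂μ) :=
      ((Finset.measurable_fun_sum _ fun i _ =>
        hYm.comp (measurable_pi_apply i)).sub_const _).const_mul _
    rw [charFun_apply, charFun_apply, integral_map (hVm n).aemeasurable (by fun_prop),
      integral_map hSm.aemeasurable (by fun_prop)]
    refine integral_congr_ae (Eventually.of_forall fun ω => ?_)
    have hin : inner ℝ (WithLp.toLp 2 fun j =>
        (Real.sqrt n)⁻¹ * ∑ i ∈ Finset.range n, W j (ω i) : EuclideanSpace ℝ ι) t =
        inner ℝ ((Real.sqrt n)⁻¹ *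
          (∑ i ∈ Finset.range n, Y (ω i) - n * ∫ ω, Y (ω 0) ∂μ)) (1 : ℝ) := by
      rw [hint Y hYm, hY0]
      simp only [PiLp.inner_apply, RCLike.inner_apply, conj_trivial, mul_zero, sub_zero, one_mul, hY]
      rw [Finset.sum_comm, Finset.mul_sum]
      refine Finset.sum_congr rfl fun j _ => ?_
      rw [← Finset.mul_sum]
      ring
    simp only [hin]
  · congr 2
    have : ((‖t‖ ^ 2).toNNReal : ℝ) = ‖t‖ ^ 2 := Real.coe_toNNReal _ (by positivity)
    simp [this, neg_div]

lemma VanishesInProb.sum_abs {P : Measure E} [IsProbabilityMeasure P]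
    {X : ι → (n : ℕ) → (Fin n → E) → ℝ} (hX : ∀ j, VanishesInProb P (X j)) :
    VanishesInProb P fun n w => ∑ j, |X j n w| := by
  classical
  suffices h : ∀ s : Finset ι, VanishesInProb P fun n w => ∑ j ∈ s, |X j n w| from h Finset.univ
  intro s
  induction s using Finset.induction_on with
  | empty =>
    intro δ hδ
    simp [not_le.2 hδ]
  | insert j s hj ih =>
    simp only [Finset.sum_insert hj]
    refine VanishesInProb.add (fun δ hδ => ?_) ih
    simpa using hX j δ hδ

/-- The first `n` terms of an i.i.d. sequence are an `n`-sample. -/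
lemma measurePreserving_truncate (P : Measure E) [IsProbabilityMeasure P] (n : ℕ) :
    MeasurePreserving (fun (ω : ℕ → E) (i : Fin n) => ω i)
      (Measure.infinitePi fun _ : ℕ => P) (Measure.pi fun _ : Fin n => P) := by
  refine ⟨measurable_pi_lambda _ fun i => measurable_pi_apply _, ?_⟩
  have hind := (iIndepFun_infinitePi (P := fun _ : ℕ => P) (X := fun _ x => x)
    fun _ => measurable_id).precomp (g := fun i : Fin n => (i : ℕ)) Fin.val_injective
  rw [iIndepFun_iff_map_fun_eq_pi_map fun i => (measurable_pi_apply _).aemeasurable] at hind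
  rw [hind]
  congr 1
  funext i
  exact (measurePreserving_eval_infinitePi (fun _ : ℕ => P) i).map_eq

/-- Statistics that are asymptotically equivalent to normalized sums of orthonormal variables have
an asymptotically chi-squared sum of squares. -/
theorem tendstoInDistribution_sum_sq (P : Measure E) [IsProbabilityMeasure P]
    {W : ι → E → ℝ} (hW : ∀ j, Measurable (W j)) {C : ℝ} (hC : ∀ j x, |W j x| ≤ C)
    (h0 : ∀ j, ∫ x, W j x ∂P = 0)
    (h1 : ∀ j, ∫ x, W j x ^ 2 ∂P = 1) (h2 : ∀ j k, j ≠ k → ∫ x, W j x * W k x ∂P = 0)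
    {R : ι → (n : ℕ) → (Fin n → E) → ℝ} (hR : ∀ j n, Measurable (R j n))
    (hRW : ∀ j, VanishesInProb P fun n w => R j n w - (Real.sqrt n)⁻¹ * ∑ i, W j (w i)) :
    TendstoInDistribution (fun n (w : Fin n → E) => ∑ j, R j n w ^ 2) atTop
      (fun x : ι → ℝ => ∑ j, x j ^ 2) (fun n => Measure.pi fun _ : Fin n => P)
      (Measure.pi fun _ : ι => gaussianReal 0 1) := by
  have hclt := tendstoInDistribution_stdGaussian P hW hC h0 h1 h2
  set V : ℕ → (ℕ → E) → EuclideanSpace ℝ ι := fun n ω => WithLp.toLp 2 fun j =>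
    (Real.sqrt n)⁻¹ * ∑ i ∈ Finset.range n, W j (ω i)
  set Y : ℕ → (ℕ → E) → EuclideanSpace ℝ ι := fun n ω =>
    WithLp.toLp 2 fun j => R j n fun i => ω i
  have htr := measurePreserving_truncate P
  have hYm : ∀ n, Measurable (Y n) := fun n =>
    (WithLp.measurable_toLp 2 _).comp
      (measurable_pi_lambda _ fun j => (hR j n).comp (htr n).measurable)
  -- All statistics are lifted to one space of infinite sequences, where convergence in measure
  -- makes sense; the laws are transferred back at the end.
  have hdiff : TendstoInMeasure (Measure.infinitePi fun _ : ℕ => P) (Y - V) atTop 0 := by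
    rw [tendstoInMeasure_iff_measureReal_norm]
    intro δ hδ
    refine squeeze_zero (fun _ => measureReal_nonneg) (fun n => ?_)
      (VanishesInProb.sum_abs hRW δ hδ)
    have hSm : MeasurableSet {w : Fin n → E |
        δ ≤ |(∑ j, |R j n w - (Real.sqrt n)⁻¹ * ∑ i, W j (w i)|)|} := by
      refine measurableSet_le measurable_const (continuous_abs.measurable.comp
        (Finset.measurable_fun_sum _ fun j _ => continuous_abs.measurable.comp
          ((hR j n).sub ((Finset.measurable_fun_sum _ fun i _ => ?_).const_mul _))))
      exact (hW j).comp (measurable_pi_apply i)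
    rw [measureReal_def, measureReal_def, ← (htr n).measure_preimage hSm.nullMeasurableSet]
    refine ENNReal.toReal_mono (measure_ne_top _ _) (measure_mono fun ω hω => ?_)
    have hω' : δ ≤ ‖Y n ω - V n ω‖ := by simpa using hω
    have hcoord : ∀ j, (Y n ω - V n ω) j =
        R j n (fun i => ω i) - (Real.sqrt n)⁻¹ * ∑ i : Fin n, W j (ω i) := fun j => by
      rw [Fin.sum_univ_eq_sum_range (fun i => W j (ω i))]
      rfl
    have hle : ‖Y n ω - V n ω‖ ≤ ∑ j, |(Y n ω - V n ω) j| := by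
      rw [EuclideanSpace.norm_eq, Real.sqrt_le_left (Finset.sum_nonneg fun j _ => abs_nonneg _)]
      exact Finset.sum_sq_le_sq_sum_of_nonneg fun j _ => abs_nonneg _
    simp only [hcoord] at hle
    exact hω'.trans (hle.trans (le_abs_self _))
  have hlim := tendstoInDistribution_of_tendstoInMeasure_sub Y id hclt hdiff
    fun n => (hYm n).aemeasurable
  have hsq := hlim.continuous_comp (g := fun v : EuclideanSpace ℝ ι => ∑ j, v j ^ 2)
    (by fun_prop)
  have hRm : ∀ n, Measurable fun w : Fin n → E => ∑ j, R j n w ^ 2 := fun n =>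
    Finset.measurable_fun_sum _ fun j _ => (hR j n).pow_const 2
  refine hsq.of_map_eq (fun n => (hRm n).aemeasurable) (Measurable.aemeasurable (by fun_prop))
    (fun n => ?_) ?_
  · rw [← (htr n).map_eq, Measure.map_map (hRm n) (htr n).measurable]
    rfl
  · rw [← map_pi_eq_stdGaussian, Measure.map_map (by fun_prop) (WithLp.measurable_toLp 2 _)]
    rfl

end CentralLimit

lemma map_sum_sq_gaussian {ι : Type*} [Fintype ι] {k : ℕ} (e : ι ≃ Fin k) :
    (Measure.pi fun _ : ι => gaussianReal 0 1).map (fun x : ι → ℝ => ∑ j, x j ^ 2) =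
      chiSquared k := by
  have h := measurePreserving_piCongrLeft (fun _ : Fin k => gaussianReal 0 1) e
  rw [chiSquared, ← h.map_eq, Measure.map_map (by fun_prop) h.measurable]
  congr 1
  funext x
  simp only [Function.comp_apply]
  rw [← e.sum_comp]
  simp [MeasurableEquiv.piCongrLeft]


/-! ### Whitening of the correlation map -/

section Whitening

variable {q : ℕ} {φ : Fin q → I → ℝ}

lemma IsCorrelationMap.continuous (hφ : IsCorrelationMap φ) (k : Fin q) : Continuous (φ k) :=
  (hφ.lipschitz k).choose_spec.continuous

lemma integrable_of_continuous {f : I → ℝ} (hf : Continuous f) : Integrable f :=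
  hf.integrable_of_hasCompactSupport (HasCompactSupport.of_compactSpace f)

/-- Needed for a nonzero continuous square to have a strictly positive integral. -/
instance isOpenPosMeasure_unitInterval : (volume : Measure I).IsOpenPosMeasure where
  open_pos U hU hne := by
    obtain ⟨a, b, hab, hsub⟩ := hU.exists_Ioo_subset hne
    refine (lt_of_lt_of_le ?_ (measure_mono hsub)).ne'
    rw [unitInterval.volume_Ioo]
    exact ENNReal.ofReal_pos.2 (sub_pos.2 hab)

lemma integral_linearCombination_mul (hφ : IsCorrelationMap φ) (x y : Fin q → ℝ) :
    ∫ u, (∑ k, x k * φ k u) * ∑ s, y s * φ s u = ∑ k, ∑ s, x k * sigmaMatrix φ k s * y s := by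
  have hc : ∀ k s, Continuous fun u => x k * φ k u * (y s * φ s u) := fun k s =>
    (continuous_const.mul (hφ.continuous k)).mul (continuous_const.mul (hφ.continuous s))
  simp only [Finset.sum_mul_sum]
  rw [integral_finsetSum _ fun k _ => integrable_finsetSum _ fun s _ =>
    integrable_of_continuous (hc k s)]
  refine Finset.sum_congr rfl fun k _ => ?_
  rw [integral_finsetSum _ fun s _ => integrable_of_continuous (hc k s)]
  refine Finset.sum_congr rfl fun s _ => ?_
  rw [sigmaMatrix, Matrix.of_apply, ← integral_const_mul, ← integral_mul_const]
  refine integral_congr_ae (Eventually.of_forall fun u => ?_)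
  ring

/-- The quadratic form at `x` is `∫ (∑ x_k φ_k)²`; by linear independence its continuous integrand
is nonzero somewhere when `x ≠ 0`. -/
lemma posDef_sigmaMatrix (hφ : IsCorrelationMap φ) : (sigmaMatrix φ).PosDef := by
  refine .of_dotProduct_mulVec_pos ?_ fun x hx => ?_
  · ext k s
    simp [sigmaMatrix, mul_comm]
  · have hc : Continuous fun u => ∑ k, x k * φ k u :=
      continuous_finsetSum _ fun k _ => continuous_const.mul (hφ.continuous k)
    have hquad : star x ⬝ᵥ (sigmaMatrix φ).mulVec x = ∫ u, (∑ k, x k * φ k u) ^ 2 := by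
      simp only [sq]
      rw [integral_linearCombination_mul hφ]
      simp [dotProduct, Matrix.mulVec, Finset.mul_sum, mul_assoc]
    obtain ⟨u, hu⟩ : ∃ u, ∑ k, x k * φ k u ≠ 0 := by
      by_contra! hall
      refine hx (funext (Fintype.linearIndependent_iff.1 hφ.linearIndependent x ?_))
      funext u
      simpa using hall u
    rw [hquad]
    exact (hc.pow 2).integral_pos_of_hasCompactSupport_nonneg_nonzero
      (HasCompactSupport.of_compactSpace _) (fun u => sq_nonneg _) (pow_ne_zero 2 hu)

lemma isSymm_invSqrt (A : Matrix (Fin q) (Fin q) ℝ) : (invSqrt A).IsSymm := by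
  have h : IsSelfAdjoint (invSqrt A) := cfc_predicate _ _
  have h' : (invSqrt A).conjTranspose = invSqrt A := h
  rwa [Matrix.conjTranspose_eq_transpose_of_trivial] at h'

/-- The functional calculus reduces this to `x^(-1/2) x x^(-1/2) = 1` on the spectrum, which is
positive. -/
lemma invSqrt_mul_mul_invSqrt {A : Matrix (Fin q) (Fin q) ℝ} (hA : A.PosDef) :
    invSqrt A * A * invSqrt A = 1 := by
  have hsa : IsSelfAdjoint A := hA.isHermitian
  have hpos : ∀ x ∈ spectrum ℝ A, 0 < x := fun x hx => by
    rw [hA.isHermitian.spectrum_real_eq_range_eigenvalues] at hx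
    obtain ⟨i, rfl⟩ := hx
    exact hA.eigenvalues_pos i
  have hc : ContinuousOn (fun x : ℝ => (Real.sqrt x)⁻¹) (spectrum ℝ A) :=
    Real.continuous_sqrt.continuousOn.inv₀ fun x hx => (Real.sqrt_pos.2 (hpos x hx)).ne'
  have hid : cfc (fun x : ℝ => x) A = A := cfc_id' ℝ A
  calc invSqrt A * A * invSqrt A
      = cfc (fun x : ℝ => (Real.sqrt x)⁻¹) A * cfc (fun x : ℝ => x) A *
          cfc (fun x : ℝ => (Real.sqrt x)⁻¹) A := by rw [hid]; rfl
    _ = cfc (fun x : ℝ => (Real.sqrt x)⁻¹ * x * (Real.sqrt x)⁻¹) A := by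
        rw [← cfc_mul (fun x : ℝ => (Real.sqrt x)⁻¹) (fun x => x) A hc continuousOn_id,
          ← cfc_mul (fun x : ℝ => (Real.sqrt x)⁻¹ * x) _ A (hc.mul continuousOn_id) hc]
    _ = cfc (fun _ : ℝ => (1 : ℝ)) A := by
        refine cfc_congr fun x hx => ?_
        have hs := Real.sqrt_pos.2 (hpos x hx)
        have := Real.mul_self_sqrt (hpos x hx).le
        field_simp
        nlinarith
    _ = 1 := cfc_const_one ℝ A

/-- The coordinates of `Σ^(-1/2) φ`. -/
noncomputable def whitened (φ : Fin q → I → ℝ) (a : Fin q) (u : I) : ℝ :=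
  ∑ k, invSqrt (sigmaMatrix φ) a k * φ k u

lemma exists_lipschitzWith_whitened (hφ : IsCorrelationMap φ) (a : Fin q) :
    ∃ L, LipschitzWith L (whitened φ a) := by
  choose L hL using hφ.lipschitz
  refine ⟨∑ k, ‖invSqrt (sigmaMatrix φ) a k‖₊ * L k, LipschitzWith.of_dist_le_mul fun u v => ?_⟩
  simp only [whitened, Real.dist_eq, ← Finset.sum_sub_distrib, ← mul_sub]
  refine (Finset.abs_sum_le_sum_abs _ _).trans ?_
  push_cast
  rw [Finset.sum_mul]
  refine Finset.sum_le_sum fun k _ => ?_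
  rw [abs_mul, mul_assoc]
  exact mul_le_mul_of_nonneg_left ((hL k).dist_le_mul u v) (abs_nonneg _)

lemma integral_whitened (hφ : IsCorrelationMap φ) (a : Fin q) : ∫ u, whitened φ a u = 0 := by
  simp only [whitened]
  rw [integral_finsetSum _ fun k _ => (integrable_of_continuous (hφ.continuous k)).const_mul _]
  simp [integral_const_mul, hφ.integral_eq_zero]

/-- The Gram matrix of `Σ^(-1/2) φ` is `Σ^(-1/2) Σ Σ^(-1/2)`. -/
lemma integral_whitened_mul (hφ : IsCorrelationMap φ) (a b : Fin q) :
    ∫ u, whitened φ a u * whitened φ b u = if a = b then 1 else 0 := by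
  simp only [whitened]
  rw [integral_linearCombination_mul hφ, ← Matrix.one_apply,
    ← invSqrt_mul_mul_invSqrt (posDef_sigmaMatrix hφ), Matrix.mul_apply]
  simp only [Matrix.mul_apply, Finset.sum_mul]
  rw [Finset.sum_comm]
  refine Finset.sum_congr rfl fun s _ => Finset.sum_congr rfl fun k _ => ?_
  rw [(isSymm_invSqrt (sigmaMatrix φ)).apply s b]

lemma exists_abs_whitened_le (hφ : IsCorrelationMap φ) : ∃ C, ∀ a u, |whitened φ a u| ≤ C := by
  have h : ∀ a, ∃ C, ∀ u, |whitened φ a u| ≤ C := fun a => by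
    obtain ⟨L, hL⟩ := exists_lipschitzWith_whitened hφ a
    obtain ⟨C, hC⟩ := isCompact_univ.exists_bound_of_continuousOn hL.continuous.continuousOn
    exact ⟨C, fun u => hC u (Set.mem_univ u)⟩
  choose C hC using h
  refine ⟨∑ a, |C a|, fun a u => (hC a u).trans ((le_abs_self _).trans ?_)⟩
  exact Finset.single_le_sum (f := fun a => |C a|) (fun a _ => abs_nonneg _) (Finset.mem_univ a)

lemma natCast_mul_testStat {d : ℕ} (φ : Fin q → I → ℝ) (Fhat Ghat : CondCDFEstimator d) (n : ℕ)
    (w : Fin n → Obs d) :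
    n * testStat φ Fhat Ghat n w = ∑ j : Fin q × Fin q, ((Real.sqrt n)⁻¹ * ∑ i,
      whitened φ j.1 (Fhat.est n (sampleXZ w) (w i).2.2 (w i).1) *
        whitened φ j.2 (Ghat.est n (sampleYZ w) (w i).2.2 (w i).2.1)) ^ 2 := by
  have hentry : ∀ a b, (invSqrt (sigmaMatrix φ) * rhoHat φ Fhat Ghat n w *
      invSqrt (sigmaMatrix φ)) a b = (n : ℝ)⁻¹ * ∑ i,
        whitened φ a (Fhat.est n (sampleXZ w) (w i).2.2 (w i).1) *
          whitened φ b (Ghat.est n (sampleYZ w) (w i).2.2 (w i).2.1) := fun a b => by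
    simp only [Matrix.mul_apply, rhoHat, Matrix.of_apply, whitened, Finset.sum_mul_sum]
    simp only [Finset.mul_sum, Finset.sum_mul]
    rw [Finset.sum_comm]
    conv_rhs => rw [Finset.sum_comm]
    refine Finset.sum_congr rfl fun k _ => ?_
    rw [Finset.sum_comm]
    refine Finset.sum_congr rfl fun i _ => Finset.sum_congr rfl fun l _ => ?_
    rw [(isSymm_invSqrt (sigmaMatrix φ)).apply b l]
    ring
  have hsq : testStat φ Fhat Ghat n w = ∑ a, ∑ b, (invSqrt (sigmaMatrix φ) *
      rhoHat φ Fhat Ghat n w * invSqrt (sigmaMatrix φ)) a b ^ 2 :=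
    Real.sq_sqrt (Finset.sum_nonneg fun a _ => Finset.sum_nonneg fun b _ => sq_nonneg _)
  rw [hsq, Fintype.sum_prod_type, Finset.mul_sum]
  refine Finset.sum_congr rfl fun a _ => ?_
  rw [Finset.mul_sum]
  refine Finset.sum_congr rfl fun b _ => ?_
  rw [hentry, mul_pow, mul_pow, inv_pow, inv_pow, Real.sq_sqrt (Nat.cast_nonneg n), ← mul_assoc]
  congr 1
  rcases eq_or_ne (n : ℝ) 0 with h | h
  · simp [h]
  · field_simp

end Whitening

/-! ### The estimated residuals -/

section Residuals

variable {q d : ℕ} {E : Type*} [MeasurableSpace E]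

/-- Consistency of the estimator passes to the transformed residuals. -/
lemma uniformlyBoundedInProb_residual_error {φ : Fin q → I → ℝ} {a b : I}
    (ha : (a : ℝ) = tauMin φ) (hb : (b : ℝ) = tauMax φ) (hab : a ≤ b) {ψ : I → ℝ} {L : NNReal}
    (hψ : LipschitzWith L ψ) (hψa : ∀ u, u ≤ a → ψ u = 0) (hψb : ∀ u, b ≤ u → ψ u = 0)
    (κ : Kernel (Cube d) I) [IsMarkovKernel κ] {F : Cube d → I → ℝ}
    (hF : ∀ z t, F z t = (κ z).real (Set.Iic t)) (e : CondCDFEstimator d)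
    (P : Measure E) [IsProbabilityMeasure P] {p : E → I × Cube d}
    (hatom : ∀ᵐ x ∂P, ∀ t, κ (p x).2 {t} = 0) {g : ℕ → ℝ}
    (hO : ∀ ε : ℝ, 0 < ε → ∃ M : ℝ, 0 < M ∧ ∀ n : ℕ, 1 ≤ n →
      (Measure.pi fun _ : Fin n => P) {w | ENNReal.ofReal (M * |g n|) <
        supOver (quantileRange φ F) fun z t => F z t - e.est n (fun i => p (w i)) z t} <
          ENNReal.ofReal ε) :
    UniformlyBoundedInProb P (fun n w i => ψ (e.est n (fun j => p (w j)) (p (w i)).2 (p (w i)).1) -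
      ψ (distFun (κ (p (w i)).2) (p (w i)).1)) g := by
  intro ε hε
  obtain ⟨M, hM, hMO⟩ := hO ε hε
  -- The Lipschitz constant may be zero, so `+ 1` keeps the witness positive.
  refine ⟨L * M + 1, by positivity, fun n hn => ?_⟩
  refine ENNReal.toReal_le_of_le_ofReal hε.le (le_trans ?_ (hMO n hn).le)
  have hgood : ∀ᵐ w ∂(Measure.pi fun _ : Fin n => P), ∀ i, ∀ t, κ (p (w i)).2 {t} = 0 :=
    eventually_all.2 fun i =>
      (Measure.tendsto_eval_ae_ae (μ := fun _ : Fin n => P) (i := i)).eventually hatom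
  refine measure_mono_ae ?_
  filter_upwards [hgood] with w hw hbad
  obtain ⟨i, hi⟩ := hbad
  by_contra hle
  have hr : 0 ≤ M * |g n| := by positivity
  have := abs_residual_error_le ha hb hab hψ hψa hψb κ hF
    (e.monotone_est n fun j => p (w j)) hr (not_lt.1 hle) (hw i) (p (w i)).1
  have hi' := hi.trans_le this
  nlinarith [abs_nonneg (g n)]

lemma measurable_residual_error {ψ : I → ℝ} (hψ : Measurable ψ) (κ : Kernel (Cube d) I)
    [IsMarkovKernel κ] (e : CondCDFEstimator d) (n : ℕ) (i : Fin n) :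
    Measurable fun s : Fin n → I × Cube d =>
      ψ (e.est n s (s i).2 (s i).1) - ψ (distFun (κ (s i).2) (s i).1) := by
  have hi : Measurable fun s : Fin n → I × Cube d => ((s i).2, (s i).1) :=
    ((measurable_pi_apply i).snd).prodMk ((measurable_pi_apply i).fst)
  exact (hψ.comp ((e.measurable_est n).comp (measurable_id.prodMk hi))).sub
    (hψ.comp ((measurable_distFun_kernel κ).comp hi))

end Residuals

end PartialCopula

theorem corollary4p4 {q d : ℕ} (hq : 1 ≤ q)
    (φ : Fin q → I → ℝ) (hφ : IsCorrelationMap φ)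
    (Fhat Ghat : CondCDFEstimator d)
    (𝒫₀ : Set (ProbabilityMeasure (Obs d)))
    (h_ac : ∀ P ∈ 𝒫₀, (P : Measure (Obs d)) ≪ volume)
    (F G : ProbabilityMeasure (Obs d) → Cube d → I → ℝ)
    (hF : ∀ P ∈ 𝒫₀, IsCondCDF (lawZX (P : Measure (Obs d))) (F P))
    (hG : ∀ P ∈ 𝒫₀, IsCondCDF (lawZY (P : Measure (Obs d))) (G P))
    (g h : ProbabilityMeasure (Obs d) → ℕ → ℝ)
    (h_cons : ∀ P ∈ 𝒫₀, ConsistentAt φ Fhat Ghat P (F P) (G P) (g P) (h P))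
    (h_rate : ∀ P ∈ 𝒫₀, Tendsto (fun n : ℕ => Real.sqrt n * g P n * h P n) atTop (𝓝 0)) :
    ∀ P ∈ 𝒫₀, CondIndepXY P →
      TendstoInDistribution
        (fun (n : ℕ) (w : Fin n → Obs d) => (n : ℝ) * testStat φ Fhat Ghat n w)
        atTop (id : ℝ → ℝ) (fun n => sampleLaw P n) (chiSquared (q ^ 2)) := by
  intro P hP hind
  obtain ⟨κ, hκ, hκc, hFκ⟩ := hF P hP
  obtain ⟨κ', hκ', hκc', hGκ⟩ := hG P hP
  obtain ⟨hg0, hh0, hgO, hhO, -⟩ := h_cons P hP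
  have hrate := h_rate P hP
  have hac := h_ac P hP
  obtain ⟨a, b, ha, hb, hab, hφa, hφb⟩ := hφ.exists_support_bounds hq
  obtain ⟨C, hC⟩ := exists_abs_whitened_le hφ
  choose L hL using exists_lipschitzWith_whitened hφ
  have hψa : ∀ k u, u ≤ a → whitened φ k u = 0 := fun k u hu => by
    simp [whitened, fun k => hφa k u hu]
  have hψb : ∀ k u, b ≤ u → whitened φ k u = 0 := fun k u hu => by
    simp [whitened, fun k => hφb k u hu]
  have hψm : ∀ k, Measurable (whitened φ k) := fun k => (hL k).continuous.measurable
  have hψ1 : ∀ k, ∫ u, whitened φ k u ^ 2 = 1 := fun k => by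
    simpa [sq] using integral_whitened_mul hφ k k
  set μ : Measure (Obs d) := (P : Measure (Obs d)) with hμ
  -- the coordinates and the residuals
  have hXm : Measurable fun w : Obs d => w.1 := measurable_fst
  have hYm : Measurable fun w : Obs d => w.2.1 := measurable_snd.fst
  have hZm : Measurable fun w : Obs d => w.2.2 := measurable_snd.snd
  set U : Obs d → I := fun w => distFun (κ w.2.2) w.1 with hU
  set V : Obs d → I := fun w => distFun (κ' w.2.2) w.2.1 with hV
  have hUm : Measurable U := (measurable_distFun_kernel κ).comp (hZm.prodMk hXm)
  have hVm : Measurable V := (measurable_distFun_kernel κ').comp (hZm.prodMk hYm)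
  have hZX : (lawZX μ).fst = μ.map fun w => w.2.2 := by
    rw [Measure.fst, lawZX, Measure.map_map measurable_fst (hZm.prodMk hXm)]; rfl
  have hZY : (lawZY μ).fst = μ.map fun w => w.2.2 := by
    rw [Measure.fst, lawZY, Measure.map_map measurable_fst (hZm.prodMk hYm)]; rfl
  have : IsProbabilityMeasure (lawZX μ) :=
    Measure.isProbabilityMeasure_map (hZm.prodMk hXm).aemeasurable
  have : IsProbabilityMeasure (lawZY μ) :=
    Measure.isProbabilityMeasure_map (hZm.prodMk hYm).aemeasurable
  have hdis : lawZX μ = (μ.map fun w => w.2.2) ⊗ₘ κ := by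
    rw [← hZX]; exact hκc.disintegrate.symm
  have hdis' : lawZY μ = (μ.map fun w => w.2.2) ⊗ₘ κ' := by
    rw [← hZY]; exact hκc'.disintegrate.symm
  have hatom := ae_no_atoms _ (absolutelyContinuous_lawZX hac) κ hκc.disintegrate
  have hatom' := ae_no_atoms _ (absolutelyContinuous_lawZY hac) κ' hκc'.disintegrate
  rw [hZX] at hatom
  rw [hZY] at hatom'
  have hlawV := map_residual_eq_prod μ hXm hYm hZm hind κ' hdis' hatom'
  have hlawU := map_residual_eq_prod μ hYm hXm hZm hind.symm κ hdis hatom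
  have hmapU : μ.map U = volume := by
    have h1 := congrArg (Measure.map Prod.snd) hlawU
    have : IsProbabilityMeasure (μ.map fun w : Obs d => (w.2.1, w.2.2)) :=
      Measure.isProbabilityMeasure_map (hYm.prodMk hZm).aemeasurable
    rw [Measure.map_map measurable_snd ((hYm.prodMk hZm).prodMk hUm), Measure.map_snd_prod,
      measure_univ, one_smul] at h1
    exact h1
  -- `U` is a function of `(X, Z)`, so the product law passes to `(U, V)`.
  have hmapUV : μ.map (fun w => (U w, V w)) = volume.prod volume := by
    have hf : Measurable fun x : I × Cube d => distFun (κ x.2) x.1 :=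
      (measurable_distFun_kernel κ).comp measurable_swap
    have h1 := congrArg (Measure.map (Prod.map (fun x : I × Cube d => distFun (κ x.2) x.1) id)) hlawV
    have : IsProbabilityMeasure (μ.map fun w : Obs d => (w.1, w.2.2)) :=
      Measure.isProbabilityMeasure_map (hXm.prodMk hZm).aemeasurable
    rw [Measure.map_map (hf.prodMap measurable_id) ((hXm.prodMk hZm).prodMk hVm),
      ← Measure.map_prod_map _ _ hf measurable_id, Measure.map_id,
      Measure.map_map hf (hXm.prodMk hZm)] at h1
    exact h1.trans (congrArg (fun ν : Measure I => ν.prod volume) hmapU)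
  have hint : ∀ f f' : I → ℝ, Measurable f → Measurable f' →
      ∫ w, f (U w) * f' (V w) ∂μ = (∫ u, f u) * ∫ u, f' u := fun f f' hf hf' => by
    rw [← integral_prod_mul, ← hmapUV, integral_map (hUm.prodMk hVm).aemeasurable]
    exact ((hf.comp measurable_fst).mul (hf'.comp measurable_snd)).aestronglyMeasurable
  -- the errors of the transformed residuals
  have hbound : ∀ k, UniformlyBoundedInProb μ _ (g P) := fun k =>
    uniformlyBoundedInProb_residual_error ha hb hab (hL k) (hψa k) (hψb k) κ hFκ Fhat μ
      (p := fun w => (w.1, w.2.2)) (ae_of_ae_map hZm.aemeasurable hatom) hgO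
  have hbound' : ∀ k, UniformlyBoundedInProb μ _ (h P) := fun k =>
    uniformlyBoundedInProb_residual_error ha hb hab (hL k) (hψa k) (hψb k) κ' hGκ Ghat μ
      (p := fun w => (w.2.1, w.2.2)) (ae_of_ae_map hZm.aemeasurable hatom') hhO
  have hdiffC : ∀ k (u v : I), |whitened φ k u - whitened φ k v| ≤ C + C := fun k u v =>
    (abs_sub _ _).trans (add_le_add (hC k u) (hC k v))
  -- The three error terms: `A ψ_l(V)`, then `ψ_k(U) B`, then `A B`.
  have hα : ∀ k l, VanishesInProb μ _ := fun k l =>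
    vanishesInProb_sum_mul_residual (hXm.prodMk hZm) hVm hlawV (hψm l) (hC l)
      (integral_whitened hφ l) (hψ1 l) (measurable_residual_error (hψm k) κ Fhat)
      (fun n s i => hdiffC k _ _) hg0 (hbound k)
  have hβ : ∀ k l, VanishesInProb μ _ := fun k l =>
    vanishesInProb_sum_mul_residual (hYm.prodMk hZm) hUm hlawU (hψm k) (hC k)
      (integral_whitened hφ k) (hψ1 k) (measurable_residual_error (hψm l) κ' Ghat)
      (fun n s i => hdiffC l _ _) hh0 (hbound' l)
  have hγ : ∀ k l, VanishesInProb μ _ := fun k l =>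
    vanishesInProb_mul (hbound k) (hbound' l) hrate
  have hmain := tendstoInDistribution_sum_sq μ (ι := Fin q × Fin q)
    (W := fun j w => whitened φ j.1 (U w) * whitened φ j.2 (V w)) (C := C * C)
    (R := fun j n w => (Real.sqrt n)⁻¹ * ∑ i,
      whitened φ j.1 (Fhat.est n (sampleXZ w) (w i).2.2 (w i).1) *
        whitened φ j.2 (Ghat.est n (sampleYZ w) (w i).2.2 (w i).2.1))
    (fun j => ((hψm _).comp hUm).mul ((hψm _).comp hVm))
    (fun j w => by
      rw [abs_mul]
      exact mul_le_mul (hC _ _) (hC _ _) (abs_nonneg _) ((abs_nonneg _).trans (hC j.1 0)))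
    (fun j => by rw [hint _ _ (hψm _) (hψm _), integral_whitened hφ, zero_mul])
    (fun j => by
      simp only [mul_pow]
      rw [hint (fun u => whitened φ j.1 u ^ 2) (fun u => whitened φ j.2 u ^ 2)
        ((hψm _).pow_const 2) ((hψm _).pow_const 2), hψ1, hψ1, mul_one])
    -- The mixed moment factors into two Kronecker deltas, and distinct pairs differ in some
    -- coordinate.
    (fun j k hjk => by
      simp only [mul_mul_mul_comm (whitened φ j.1 _)]
      rw [hint (fun u => whitened φ j.1 u * whitened φ k.1 u)
        (fun u => whitened φ j.2 u * whitened φ k.2 u) ((hψm _).mul (hψm _))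
        ((hψm _).mul (hψm _)), integral_whitened_mul hφ, integral_whitened_mul hφ]
      by_cases h1 : j.1 = k.1
      · have h2 : j.2 ≠ k.2 := fun h2 => hjk (Prod.ext h1 h2)
        simp [h2]
      · simp [h1])
    (fun j n => by
      have hXZ : Measurable fun w : Fin n → Obs d => sampleXZ w :=
        measurable_pi_lambda _ fun i => (hXm.prodMk hZm).comp (measurable_pi_apply i)
      have hYZ : Measurable fun w : Fin n → Obs d => sampleYZ w :=
        measurable_pi_lambda _ fun i => (hYm.prodMk hZm).comp (measurable_pi_apply i)
      refine (Finset.measurable_fun_sum _ fun i _ => Measurable.mul ?_ ?_).const_mul _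
      · exact (hψm _).comp ((Fhat.measurable_est n).comp
          (hXZ.prodMk ((hZm.prodMk hXm).comp (measurable_pi_apply i))))
      · exact (hψm _).comp ((Ghat.measurable_est n).comp
          (hYZ.prodMk ((hZm.prodMk hYm).comp (measurable_pi_apply i)))))
    (fun j => by
      have h3 := ((hα j.1 j.2).add (hβ j.1 j.2)).add (hγ j.1 j.2)
      convert h3 using 3 with n w
      rw [← mul_sub, ← mul_add, ← mul_add, ← Finset.sum_sub_distrib, ← Finset.sum_add_distrib,
        ← Finset.sum_add_distrib]
      congr 1
      refine Finset.sum_congr rfl fun i _ => ?_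
      have hXZ : sampleXZ w = fun j => ((w j).1, (w j).2.2) := rfl
      have hYZ : sampleYZ w = fun j => ((w j).2.1, (w j).2.2) := rfl
      rw [hXZ, hYZ]
      ring)
  refine hmain.of_map_eq (fun n => ?_) aemeasurable_id (fun n => ?_) ?_
  · simp only [natCast_mul_testStat]
    exact hmain.forall_aemeasurable n
  · simp only [natCast_mul_testStat]
    rfl
  · rw [Measure.map_id, map_sum_sq_gaussian (finProdFinEquiv.trans (finCongr (sq q).symm))]
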